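/- **Theorem 9.4 (Multistable Lévy motion).** Let $\Pi$ be a Poisson process on $\mathbb R^2$ with mean measure the Lebesgue measure $\mathcal L^2$; write $(\mathsf X,\mathsf Y)$ for its points, and $y^{\langle b\rangle}=\operatorname{sign}(y)|y|^b$. Sums over $\Pi$ are understood as $$\sum_{(\mathsf X,\mathsf Y)\in\Pi} g(\mathsf X,\mathsf Y)=\lim_{n\to\infty}\ \sum_{(\mathsf X,\mathsf Y)\in\Pi,\ \mathsf X\in E_n,\ |\mathsf Y|\le n} g(\mathsf X,\mathsf Y),$$ where $E_1\subseteq E_2\subseteq\cdots$ are arbitrary fixed measurable sets of finite length with union $\mathbb R$. Let $\mathbf 1_{[0,t]}$ be the indicator function of $[0,t]$, read as $-\mathbf 1_{[t,0]}$ if $t<0$, and put $$c(\beta)=\left(2\,\Gamma(1-\beta)\cos(\tfrac12\pi\beta)\right)^{-1/\beta}\quad(0<\beta<2,\ \beta\neq1),\qquad c(1)=1/\pi .$$ For $0<\beta<2$ let $$L_\beta(t)=c(\beta)\sum_{(\mathsf X,\mathsf Y)\in\Pi}\mathbf 1_{[0,t]}(\mathsf X)\,\mathsf Y^{\langle-1/\beta\rangle}\qquad(t\in\mathbb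 R).$$ Let $\alpha:\mathbb R\to(0,2)$ and $a:\mathbb R\to(0,\infty)$ be continuously differentiable, and define $$Y(t)=a(t)\,c(\alpha(t))\sum_{(\mathsf X,\mathsf Y)\in\Pi}\mathbf 1_{[0,t]}(\mathsf X)\,\mathsf Y^{\langle-1/\alpha(t)\rangle}\qquad(t\in\mathbb R).$$ A process $Y$ is called $h$-localisable at $u$ with local form $Y'_u$ if $r^{-h}\,(Y(u+rt)-Y(u))$, $t\in\mathbb R$, converges to $Y'_u(t)$, $t\in\mathbb R$, in finite-dimensional distributions as $r\searrow0$, and $Y'_u$ is not the zero process. For all $\beta\in(0,2)$ and $t\in\mathbb R$ the sum $\sum\mathbf 1_{[0,t]}(\mathsf X)\mathsf Y^{\langle-1/\beta\rangle}$ converges almost surely, absolutely if $\beta<1$; and: (a) If $1<\alpha(u)<2$, then $Y$ is $1/\alpha(u)$-localisable at $u$ with local form $a(u)L_{\alpha(u)}$, and $L_{\alpha(u)}$ is, in the sense of finite-dimensional distributions, the symmetric $\alpha(u)$-stable Lévy motion: $L_{\alpha(u)}(0)=0$ a.s., its increments are independent, and $L_{\alpha(u)}(t)-L_{\alpha(u)}(s)$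 has characteristic function $\theta\mapsto\exp(-|t-s|\,|\theta|^{\alpha(u)})$. (b) If $0<\alpha(u)<1$ and $\alpha'(u)\ne0$, put $A(v)=a(v)c(\alpha(v))$ and $$W=\sum_{(\mathsf X,\mathsf Y)\in\Pi}\mathbf 1_{[0,u]}(\mathsf X)\,\mathsf Y^{\langle-1/\alpha(u)\rangle}\left(A(u)\,\frac{\alpha'(u)}{\alpha(u)^2}\,\log|\mathsf Y|+A'(u)\right).$$ This sum converges absolutely almost surely, and $r^{-1}(Y(u+rt)-Y(u))$ converges to $tW$ in finite-dimensional distributions as $r\searrow0$. If $u\neq0$, then $Y$ is $1$-localisable at $u$ with local form $\{tW:t\in\mathbb R\}$. -/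

import Mathlib

open MeasureTheory ProbabilityTheory Filter Topology
open scoped ENNReal

noncomputable section

namespace Multistable

/-- `S` is a Poisson process on `X` with mean measure `μ`: a random countable set of points such
that the number of points in a measurable set `A` is a Poisson random variable with mean `μ A`
(almost surely infinite if `μ A = ∞`), and the numbers of points in finitely many
pairwise disjoint measurable sets are independent. -/
structure IsPoissonProcess {Ω X : Type*} [MeasurableSpace Ω] [MeasurableSpace X]
    (S : Ω → Set X) (μ : Measure X) (P : Measure Ω) : Prop where
  countable : ∀ ω, (S ω).Countable
  measurable_count : ∀ A : Set X, MeasurableSet A → Measurable fun ω => (S ω ∩ A).encard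
  law_count : ∀ A : Set X, MeasurableSet A → μ A < ∞ →
    P.map (fun ω => (S ω ∩ A).encard) =
      (poissonMeasure (μ A).toNNReal).map (fun k : ℕ => (k : ℕ∞))
  count_eq_top : ∀ A : Set X, MeasurableSet A → μ A = ∞ →
    ∀ᵐ ω ∂P, (S ω ∩ A).encard = ⊤
  indep : ∀ (n : ℕ) (A : Fin n → Set X), (∀ i, MeasurableSet (A i)) →
    Pairwise (Function.onFun Disjoint A) → iIndepFun (fun i ω => (S ω ∩ A i).encard) P

/-- `E 0 ⊆ E 1 ⊆ ...` is an exhaustion of the line by measurable sets of finite length. -/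
structure IsExhaustion (E : ℕ → Set ℝ) : Prop where
  mono : Monotone E
  measurableSet : ∀ n, MeasurableSet (E n)
  volume_lt_top : ∀ n, volume (E n) < ∞
  iUnion_eq : ⋃ n, E n = Set.univ

/-- The sum of `g` over the points of `S` in the rectangle `{(x, y) | x ∈ E n, |y| ≤ n}`. -/
def partialSum (E : ℕ → Set ℝ) (g : ℝ × ℝ → ℝ) (S : Set (ℝ × ℝ)) (n : ℕ) : ℝ :=
  ∑' p : ↥(S ∩ E n ×ˢ Set.Icc (-(n : ℝ)) n), g p

/-- The sum of `g` over the points of `S`, as the limit of the sums over growing rectangles. -/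
def poissonSum (E : ℕ → Set ℝ) (g : ℝ × ℝ → ℝ) (S : Set (ℝ × ℝ)) : ℝ :=
  limUnder atTop (partialSum E g S)

/-- `y^{<b>} = sign(y) |y|^b`. -/
def signedPow (y b : ℝ) : ℝ := Real.sign y * |y| ^ b

/-- The indicator function of `[0, t]`, read as `-1_{[t, 0]}` when `t < 0`. -/
def orientedIndicator (t x : ℝ) : ℝ :=
  if 0 ≤ t then (Set.Icc 0 t).indicator 1 x else -(Set.Icc t 0).indicator 1 x

/-- The constant `c(β) = (2 Γ(1 - β) cos(π β / 2))^{-1/β}` for `0 < β < 2`, with its limiting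
value `1 / π` at `β = 1`. -/
def stableConst (β : ℝ) : ℝ :=
  if β = 1 then Real.pi⁻¹
  else (2 * Real.Gamma (1 - β) * Real.cos (Real.pi * β / 2)) ^ (-1 / β)

/-- `(x, y) ↦ 1_{[0, t]}(x) y^{<-1/β>}`. -/
def levyKernel (β t : ℝ) (p : ℝ × ℝ) : ℝ :=
  orientedIndicator t p.1 * signedPow p.2 (-1 / β)

variable {Ω Ω' : Type*} [MeasurableSpace Ω] [MeasurableSpace Ω']

/-- The Poisson sum representation
`L_β(t) = c(β) ∑ 1_{[0, t]}(X) Y^{<-1/β>}` of the symmetric `β`-stable Lévy motion. -/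
def stableLevy (S : Ω → Set (ℝ × ℝ)) (E : ℕ → Set ℝ) (β t : ℝ) (ω : Ω) : ℝ :=
  stableConst β * poissonSum E (levyKernel β t) (S ω)

/-- Multistable Lévy motion
`Y(t) = a(t) c(α(t)) ∑ 1_{[0, t]}(X) Y^{<-1/α(t)>}`. -/
def multistableLevy (S : Ω → Set (ℝ × ℝ)) (E : ℕ → Set ℝ) (a α : ℝ → ℝ) (t : ℝ) (ω : Ω) : ℝ :=
  a t * stableConst (α t) * poissonSum E (levyKernel (α t) t) (S ω)

/-- `(x, y) ↦ 1_{[0, u]}(x) y^{<-1/α(u)>} (A(u) α'(u) / α(u)² log |y| + A'(u))`,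
where `A(v) = a(v) c(α(v))`. -/
def tangentKernel (a α : ℝ → ℝ) (u : ℝ) (p : ℝ × ℝ) : ℝ :=
  levyKernel (α u) u p *
    (a u * stableConst (α u) * (deriv α u / α u ^ 2) * Real.log |p.2| +
      deriv (fun v => a v * stableConst (α v)) u)

/-- The random variable `W`, the Poisson sum of `tangentKernel a α u`. -/
def tangentVariable (S : Ω → Set (ℝ × ℝ)) (E : ℕ → Set ℝ) (a α : ℝ → ℝ) (u : ℝ) (ω : Ω) : ℝ :=
  poissonSum E (tangentKernel a α u) (S ω)

/-- `L`, indexed by the whole line, is (in the sense of finite-dimensional distributions) the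
symmetric `β`-stable Lévy motion `L(t) = M[0, t]`: it starts at `0`, its increments are
independent, and `L(t) - L(s)` has the law `S_β(|t - s|^{1/β}, 0, 0)`, that is, characteristic
function `θ ↦ exp(-|t - s| |θ|^β)` (so the increments are stationary). -/
structure IsSymmetricStableLevyMotion (β : ℝ) (L : ℝ → Ω → ℝ) (P : Measure Ω) : Prop where
  aemeasurable : ∀ t, AEMeasurable (L t) P
  zero : ∀ᵐ ω ∂P, L 0 ω = 0
  indepIncrements : HasIndepIncrements L P
  charFun_increment : ∀ s t θ : ℝ,
    charFun (P.map (fun ω => L t ω - L s ω)) θ =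
      ((Real.exp (-(|t - s| * |θ| ^ β)) : ℝ) : ℂ)

/-- `(Y(u + r t) - Y(u)) / r^h` converges to `Y'(t)` in finite-dimensional distributions as
`r ↘ 0`. -/
def HasScalingLimit (Y : ℝ → Ω → ℝ) (h u : ℝ) (Y' : ℝ → Ω' → ℝ)
    (P : Measure Ω) [IsProbabilityMeasure P] (P' : Measure Ω') [IsProbabilityMeasure P'] : Prop :=
  ∀ (n : ℕ) (t : Fin n → ℝ),
    TendstoInDistribution (fun (r : ℝ) ω (i : Fin n) => (Y (u + r * t i) ω - Y u ω) / r ^ h)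
      (𝓝[>] 0) (fun ω' (i : Fin n) => Y' (t i) ω') (fun _ => P) P'

/-- `Y` is `h`-localisable at `u` with local form `Y'`: the scaling limit of `Y` at `u` exists in
finite-dimensional distributions, is `Y'`, and is not the zero process. -/
structure IsLocalisableAt (Y : ℝ → Ω → ℝ) (h u : ℝ) (Y' : ℝ → Ω' → ℝ)
    (P : Measure Ω) [IsProbabilityMeasure P] (P' : Measure Ω') [IsProbabilityMeasure P'] :
    Prop where
  hasScalingLimit : HasScalingLimit Y h u Y' P P'
  nontrivial : ∃ t, ¬ ∀ᵐ ω' ∂P', Y' t ω' = 0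

/-- The sum of `g` over the points of `S` converges almost surely, as the limit over growing
rectangles. -/
def SumConverges (S : Ω → Set (ℝ × ℝ)) (E : ℕ → Set ℝ) (g : ℝ × ℝ → ℝ) (P : Measure Ω) : Prop :=
  ∀ᵐ ω ∂P, Tendsto (partialSum E g (S ω)) atTop (𝓝 (poissonSum E g (S ω)))

/-- The sum of `g` over all points of `S` converges absolutely almost surely, to the same value. -/
def SumConvergesAbsolutely (S : Ω → Set (ℝ × ℝ)) (E : ℕ → Set ℝ) (g : ℝ × ℝ → ℝ)
    (P : Measure Ω) : Prop :=
  ∀ᵐ ω ∂P, HasSum (fun p : ↥(S ω) => g p) (poissonSum E g (S ω))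

end Multistable

end

/-! Everything is read off one exponential formula. If `g` is odd in the second variable and `∫ min
1 g² < ∞`, then the Poisson sum of `g` converges almost surely and `E exp(i ∑ g) = exp(-∫ (1 - cos
g))`; the sine part cancels under `y ↦ -y`. Such kernels form a vector space, so finite-dimensional
laws, independence and smallness in probability become statements about deterministic integrals. The
supporting results are `IsPoissonProcess.integral_exp_pointSum`, `IsSymmetricKernel.sumConverges`
(large terms are finite in number, small ones form an L²-bounded martingale),
`IsSymmetricKernel.integral_exp_poissonSum` and the tail bound
`IsSymmetricKernel.measureReal_lt_abs_poissonSum_le`.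

For a kernel `k(x) y^{<-1/β>}` the exponent factors as `stableIntegral β * ∫ |k|^β`, and for `β ≠ 1`
the constant `c(β)` is `stableIntegral β ^ (-1/β)`. This gives the stable characteristic function,
independent increments and exact self-similarity of `L_β`.

With `A = a · c ∘ α`, the increment `Y(v) - Y(u)` is the sum of a frozen part, `A(u)` times an
increment of the sum with constant exponent `α(u)`, and a variation part with kernel `1_{[0,v]}(x)
(A(v) y^{<-1/α(v)>} - A(u) y^{<-1/α(u)>})`. For `v = u + rt` the frozen part has exact scale
`r^{1/α(u)}` and the variation part is of order `r`. If `α(u) > 1` the frozen part dominates, and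
after scaling it has the law of the limit for each `r > 0`. If `α(u) < 1` the variation part
dominates, and its difference quotient converges in probability to `tW`. The discarded parts vanish
because `∫ min 1 g²` tends to `0`, either by dominated convergence against `decay` or by exact
scaling. -/

namespace Multistable

/-! ### Sums over the points in a set of finite measure. -/

/-- The sum of `g` over the points of `S` in `B`. -/
noncomputable def pointSum {X : Type*} (S B : Set X) (g : X → ℝ) : ℝ := ∑' p : ↥(S ∩ B), g p

lemma pointSum_eq_sum {X : Type*} {S B : Set X} (h : (S ∩ B).Finite) (g : X → ℝ) :
    pointSum S B g = ∑ p ∈ h.toFinset, g p := by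
  unfold pointSum
  have h2 := Finset.tsum_subtype' h.toFinset g
  rw [h.coe_toFinset] at h2
  exact h2

lemma tendsto_pointSum {X : Type*} {S B : Set X} (h : (S ∩ B).Finite) {f : ℕ → X → ℝ} {g : X → ℝ}
    (hfg : ∀ x, Tendsto (fun n => f n x) atTop (𝓝 (g x))) :
    Tendsto (fun n => pointSum S B (f n)) atTop (𝓝 (pointSum S B g)) := by
  simp only [pointSum_eq_sum h]
  exact tendsto_finsetSum _ fun p _ => hfg p

lemma pointSum_eq_sum_indicator {X : Type*} {S U D : Set X} (h : (S ∩ U).Finite) (hD : D ⊆ U)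
    (g : X → ℝ) : pointSum S D g = ∑ p ∈ h.toFinset, D.indicator g p := by
  classical
  have h1 : (S ∩ D).Finite := h.subset (Set.inter_subset_inter_right _ hD)
  rw [pointSum_eq_sum h1]
  refine Finset.sum_subset_zero_on_sdiff (fun x hx => ?_) (fun x hx => ?_) (fun x hx => ?_)
  · simp only [Set.Finite.mem_toFinset] at hx ⊢
    exact ⟨hx.1, hD hx.2⟩
  · simp only [Finset.mem_sdiff, Set.Finite.mem_toFinset] at hx
    exact Set.indicator_of_notMem (fun h2 => hx.2 ⟨hx.1.1, h2⟩) _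
  · simp only [Set.Finite.mem_toFinset] at hx
    exact (Set.indicator_of_mem hx.2 _).symm

lemma pointSum_eq_tsum_indicator {X : Type*} (S B : Set X) (g : X → ℝ) :
    pointSum S B g = ∑' p : ↥S, B.indicator g p := by
  rw [pointSum, tsum_subtype (S ∩ B) g, tsum_subtype S (B.indicator g), Set.indicator_indicator]

lemma pointSum_const_mul {X : Type*} (S B : Set X) (c : ℝ) (g : X → ℝ) :
    pointSum S B (fun x => c * g x) = c * pointSum S B g := tsum_mul_left

lemma pointSum_add {X : Type*} {S B : Set X} (h : (S ∩ B).Finite) (f g : X → ℝ) :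
    pointSum S B (fun x => f x + g x) = pointSum S B f + pointSum S B g := by
  simp only [pointSum_eq_sum h, Finset.sum_add_distrib]

/-- Grouping the points by the value of `g` leaves a linear combination of counts on disjoint sets,
the only quantities the Poisson axioms describe. -/
lemma pointSum_simpleFunc {X : Type*} [MeasurableSpace X] {S B : Set X} (h : (S ∩ B).Finite)
    (g : SimpleFunc X ℝ) :
    pointSum S B g = ∑ c : g.range, (c : ℝ) * ((S ∩ (g ⁻¹' {(c : ℝ)} ∩ B)).encard.toNat : ℝ) := by
  classical
  rw [pointSum_eq_sum h, Finset.sum_coe_sort g.range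
    (fun c => c * ((S ∩ (g ⁻¹' {c} ∩ B)).encard.toNat : ℝ)),
    ← Finset.sum_fiberwise_of_maps_to (s := h.toFinset) (t := g.range) (g := g)
      (fun x _ => g.mem_range_self x)]
  refine Finset.sum_congr rfl fun c _ => ?_
  have h1 : (S ∩ (g ⁻¹' {c} ∩ B)) = ↑(h.toFinset.filter fun x => g x = c) := by
    ext x; simp; tauto
  rw [h1, Set.encard_coe_eq_coe_finsetCard, ENat.toNat_natCast,
    Finset.sum_congr rfl (g := fun _ => c) (fun x hx => (Finset.mem_filter.1 hx).2)]
  simp [mul_comm]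

/-! ### Laws of sums over sets of finite measure. -/

section

variable {Ω X : Type*} [MeasurableSpace Ω] [MeasurableSpace X] {P : Measure Ω}
  {S : Ω → Set X} {μ : Measure X}

lemma IsPoissonProcess.ae_finite (hS : IsPoissonProcess S μ P) {B : Set X}
    (hB : MeasurableSet B) (hμ : μ B < ∞) : ∀ᵐ ω ∂P, (S ω ∩ B).Finite := by
  have h1 : (P.map fun ω => (S ω ∩ B).encard) {⊤} = 0 := by
    rw [hS.law_count B hB hμ, Measure.map_apply (by fun_prop) (measurableSet_singleton _)]
    convert! measure_empty (μ := poissonMeasure (μ B).toNNReal)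
    ext k; simp
  rw [Measure.map_apply (hS.measurable_count B hB) (measurableSet_singleton _)] at h1
  rw [ae_iff]
  convert! h1 using 2
  ext ω
  simp [Set.encard_eq_top_iff]

lemma IsPoissonProcess.ae_disjoint (hS : IsPoissonProcess S μ P) {B : Set X}
    (hB : MeasurableSet B) (hμ : μ B = 0) : ∀ᵐ ω ∂P, S ω ∩ B = ∅ := by
  have h1 : (P.map fun ω => (S ω ∩ B).encard) {0}ᶜ = 0 := by
    rw [hS.law_count B hB (by simp [hμ]),
      Measure.map_apply (by fun_prop) (measurableSet_singleton _).compl, hμ]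
    have h3 : poissonMeasure 0 {0} = 1 := by simp [poissonMeasure_singleton]
    have h4 : (fun k : ℕ => (k : ℕ∞)) ⁻¹' {0}ᶜ = ({0} : Set ℕ)ᶜ := by ext k; simp
    rw [h4, ENNReal.toNNReal_zero, prob_compl_eq_zero_iff (measurableSet_singleton _), h3]
  rw [Measure.map_apply (hS.measurable_count B hB) (measurableSet_singleton _).compl] at h1
  rw [ae_iff]
  convert! h1 using 2
  ext ω
  simp [Set.encard_eq_zero]

/-- Simple functions reduce the claim to measurability of counts. Only a.e. measurability is
obtained: the identities and limits are used on the event that the point set is finite. -/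
lemma IsPoissonProcess.aemeasurable_pointSum (hS : IsPoissonProcess S μ P) {B : Set X}
    (hB : MeasurableSet B) (hμ : μ B < ∞) {g : X → ℝ} (hg : Measurable g) :
    AEMeasurable (fun ω => pointSum (S ω) B g) P := by
  refine aemeasurable_of_tendsto_metrizable_ae atTop (f := fun n ω =>
    pointSum (S ω) B (hg.stronglyMeasurable.approx n)) (fun n => ?_) ?_
  · set f := hg.stronglyMeasurable.approx n
    have h1 : Measurable fun ω => ∑ c : f.range,
        (c : ℝ) * ((S ω ∩ (f ⁻¹' {(c : ℝ)} ∩ B)).encard.toNat : ℝ) := by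
      refine Finset.measurable_sum _ fun c _ => Measurable.const_mul ?_ _
      exact (measurable_of_countable (fun k : ℕ∞ => (k.toNat : ℝ))).comp
        (hS.measurable_count _ ((f.measurableSet_preimage _).inter hB))
    refine h1.aemeasurable.congr ?_
    filter_upwards [hS.ae_finite hB hμ] with ω hω
    exact (pointSum_simpleFunc hω f).symm
  · filter_upwards [hS.ae_finite hB hμ] with ω hω
    exact tendsto_pointSum hω hg.stronglyMeasurable.tendsto_approx

lemma charFun_map_mul_count [IsProbabilityMeasure P] (hS : IsPoissonProcess S μ P) {A : Set X}
    (hA : MeasurableSet A) (hμ : μ A < ∞) (c : ℝ) :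
    charFun (P.map fun ω => c * ((S ω ∩ A).encard.toNat : ℝ)) 1 =
      Complex.exp (μ.real A * (Complex.exp (c * Complex.I) - 1)) := by
  have h1 : P.map (fun ω => c * ((S ω ∩ A).encard.toNat : ℝ)) =
      ((poissonMeasure (μ A).toNNReal).map (Nat.cast : ℕ → ℝ)).map (c * ·) := by
    rw [Measure.map_map (by fun_prop) (by fun_prop)]
    have h2 : (fun ω => c * ((S ω ∩ A).encard.toNat : ℝ)) =
      (fun k : ℕ∞ => c * (k.toNat : ℝ)) ∘ (fun ω => (S ω ∩ A).encard) := rfl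
    rw [h2, ← Measure.map_map (measurable_of_countable _) (hS.measurable_count A hA),
      hS.law_count A hA hμ, Measure.map_map (measurable_of_countable _) (by fun_prop)]
    rfl
  rw [h1, charFun_map_mul, mul_one, charFun_map_cast_poissonMeasure]
  rfl

/-- For a simple function the sum is a combination of independent Poisson counts, so the
characteristic functions multiply and the exponents add up to the integral. The general case is a
limit on both sides, with dominating constants `1` and `2`. -/
lemma IsPoissonProcess.integral_exp_pointSum [IsProbabilityMeasure P]
    (hS : IsPoissonProcess S μ P) {B : Set X}
    (hB : MeasurableSet B) (hμ : μ B < ∞) {g : X → ℝ} (hg : Measurable g) :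
    ∫ ω, Complex.exp (pointSum (S ω) B g * Complex.I) ∂P =
      Complex.exp (∫ x in B, (Complex.exp (g x * Complex.I) - 1) ∂μ) := by
  have : Fact (μ B < ∞) := ⟨hμ⟩
  -- simple functions
  have key : ∀ f : SimpleFunc X ℝ, ∫ ω, Complex.exp (pointSum (S ω) B f * Complex.I) ∂P =
      Complex.exp (∫ x in B, (Complex.exp (f x * Complex.I) - 1) ∂μ) := by
    intro f
    set Z : f.range → Ω → ℝ :=
      fun c ω => (c : ℝ) * ((S ω ∩ (f ⁻¹' {(c : ℝ)} ∩ B)).encard.toNat : ℝ) with hZ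
    have hm : ∀ c : f.range, MeasurableSet (f ⁻¹' {(c : ℝ)} ∩ B) :=
      fun c => (f.measurableSet_preimage _).inter hB
    have hZm : ∀ c, Measurable (Z c) := fun c =>
      ((measurable_of_countable (fun k : ℕ∞ => (k.toNat : ℝ))).comp
        (hS.measurable_count _ (hm c))).const_mul _
    have hind : iIndepFun Z P := by
      have h1 := hS.indep (Fintype.card f.range)
        (fun i => f ⁻¹' {(((Fintype.equivFin f.range).symm i : f.range) : ℝ)} ∩ B)
        (fun i => hm _) (by
          intro i j hij
          refine Set.disjoint_left.2 fun x hx hy => hij ?_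
          have h2 := hx.1.symm.trans hy.1
          exact (Fintype.equivFin f.range).symm.injective (Subtype.ext h2))
      have h2 := h1.precomp (Fintype.equivFin f.range).injective
      simp only [Equiv.symm_apply_apply] at h2
      exact h2.comp (fun c k => (c : ℝ) * (k.toNat : ℝ)) fun c => measurable_of_countable _
    calc ∫ ω, Complex.exp (pointSum (S ω) B f * Complex.I) ∂P
        = charFun (P.map fun ω => ∑ c, Z c ω) 1 := by
          rw [charFun_apply_real, integral_map (by fun_prop) (by fun_prop)]
          refine integral_congr_ae ?_
          filter_upwards [hS.ae_finite hB hμ] with ω hω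
          rw [pointSum_simpleFunc hω f]
          simp [hZ]
      _ = ∏ c, charFun (P.map (Z c)) 1 := by
          rw [iIndepFun.charFun_map_fun_sum_eq_prod (fun c => (hZm c).aemeasurable) hind,
            Finset.prod_apply]
      _ = ∏ c : f.range, Complex.exp (μ.real (f ⁻¹' {(c : ℝ)} ∩ B) *
            (Complex.exp ((c : ℝ) * Complex.I) - 1)) := by
          refine Finset.prod_congr rfl fun c _ => ?_
          exact charFun_map_mul_count hS (hm c)
            ((measure_mono Set.inter_subset_right).trans_lt hμ) _
      _ = _ := by
          rw [← Complex.exp_sum]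
          congr 1
          have h3 := f.map_integral (μ := μ.restrict B)
            (fun c : ℝ => (Complex.exp (c * Complex.I) - 1)) f.integrable_of_isFiniteMeasure
            (by simp)
          rw [SimpleFunc.integral_eq_integral _ (SimpleFunc.integrable_of_isFiniteMeasure _)] at h3
          simp only [SimpleFunc.coe_map, Function.comp] at h3
          rw [h3, Finset.sum_coe_sort f.range
            (fun c => (μ.real (f ⁻¹' {c} ∩ B) : ℂ) * (Complex.exp (c * Complex.I) - 1))]
          refine Finset.sum_congr rfl fun c _ => ?_
          rw [measureReal_restrict_apply (f.measurableSet_preimage _)]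
          simp
  have happ := hg.stronglyMeasurable.tendsto_approx
  have hcont : Continuous fun x : ℝ => Complex.exp (x * Complex.I) := by fun_prop
  have hl : Tendsto (fun n => ∫ ω, Complex.exp
      (pointSum (S ω) B (hg.stronglyMeasurable.approx n) * Complex.I) ∂P) atTop
      (𝓝 (∫ ω, Complex.exp (pointSum (S ω) B g * Complex.I) ∂P)) := by
    refine tendsto_integral_of_dominated_convergence (fun _ => 1) (fun n => ?_)
      (integrable_const _) (fun n => ?_) ?_
    · exact (hcont.measurable.comp_aemeasurable (hS.aemeasurable_pointSum hB hμ
        (hg.stronglyMeasurable.approx n).measurable)).aestronglyMeasurable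
    · exact ae_of_all _ fun ω => (Complex.norm_exp_ofReal_mul_I _).le
    · filter_upwards [hS.ae_finite hB hμ] with ω hω
      exact (hcont.tendsto _).comp (tendsto_pointSum hω happ)
  have hr : Tendsto (fun n => ∫ x in B, (Complex.exp
      (hg.stronglyMeasurable.approx n x * Complex.I) - 1) ∂μ) atTop
      (𝓝 (∫ x in B, (Complex.exp (g x * Complex.I) - 1) ∂μ)) := by
    refine tendsto_integral_of_dominated_convergence (fun _ => 2) (fun n => ?_)
      (integrable_const _) (fun n => ?_) ?_
    · exact ((hcont.measurable.comp (hg.stronglyMeasurable.approx n).measurable).sub_const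
        _).aestronglyMeasurable
    · refine ae_of_all _ fun ω => (norm_sub_le _ _).trans ?_
      rw [Complex.norm_exp_ofReal_mul_I]; norm_num
    · exact ae_of_all _ fun x => ((hcont.tendsto _).comp (happ x)).sub_const _
  simp only [key] at hl
  exact tendsto_nhds_unique hl ((Complex.continuous_exp.tendsto _).comp hr)

end

/-! ### Independence and equality in law from characteristic functions. -/

section

variable {Ω : Type*} [MeasurableSpace Ω] {P : Measure Ω} [IsProbabilityMeasure P]

lemma iIndepFun_of_integral_exp {ι : Type*} [Fintype ι] {Z : ι → Ω → ℝ}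
    (hZ : ∀ i, AEMeasurable (Z i) P)
    (h : ∀ θ : ι → ℝ, ∫ ω, Complex.exp ((∑ i, θ i * Z i ω : ℝ) * Complex.I) ∂P =
      ∏ i, ∫ ω, Complex.exp ((θ i * Z i ω : ℝ) * Complex.I) ∂P) : iIndepFun Z P := by
  rw [iIndepFun_iff_charFun_pi hZ]
  intro t
  have h1 := h t.ofLp
  rw [charFun_apply, integral_map (by fun_prop) (by fun_prop)]
  convert! h1 using 1
  refine Finset.prod_congr rfl fun i _ => ?_
  rw [charFun_apply_real, integral_map (hZ i) (by fun_prop)]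
  simp

lemma identDistrib_of_integral_exp {Ω' : Type*} [MeasurableSpace Ω'] {P' : Measure Ω'}
    [IsProbabilityMeasure P'] {ι : Type*} [Fintype ι] {Z : ι → Ω → ℝ} {Z' : ι → Ω' → ℝ}
    (hZ : ∀ i, AEMeasurable (Z i) P) (hZ' : ∀ i, AEMeasurable (Z' i) P')
    (h : ∀ θ : ι → ℝ, ∫ ω, Complex.exp ((∑ i, θ i * Z i ω : ℝ) * Complex.I) ∂P =
      ∫ ω, Complex.exp ((∑ i, θ i * Z' i ω : ℝ) * Complex.I) ∂P') :
    IdentDistrib (fun ω i => Z i ω) (fun ω i => Z' i ω) P P' := by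
  classical
  have m1 : AEMeasurable (fun ω i => Z i ω) P := aemeasurable_pi_lambda _ hZ
  have m2 : AEMeasurable (fun ω i => Z' i ω) P' := aemeasurable_pi_lambda _ hZ'
  refine ⟨m1, m2, ?_⟩
  have := Measure.isProbabilityMeasure_map m1
  have := Measure.isProbabilityMeasure_map m2
  refine Measure.ext_of_charFunDual (funext fun L => ?_)
  -- Every dual vector is a combination of coordinates, so the hypothesis covers the whole
  -- characteristic functional.
  have hL : ∀ x : ι → ℝ, L x = ∑ i, L (Pi.single i 1) * x i := by
    intro x
    conv_lhs => rw [← ContinuousLinearMap.sum_comp_single]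
    refine Finset.sum_congr rfl fun i _ => ?_
    rw [ContinuousLinearMap.comp_apply, ContinuousLinearMap.single_apply, mul_comm, ← smul_eq_mul,
      ← map_smul, ← Pi.single_smul]
    simp
  rw [charFunDual_apply, charFunDual_apply, integral_map m1 (by fun_prop),
    integral_map m2 (by fun_prop)]
  have h1 := h fun i => L (Pi.single i 1)
  simp only [← hL] at h1
  exact h1

/-- Apply the exponential formula to `∑ θ i 1_{D i} g` on the union: the exponent splits over the
disjoint pieces. This upgrades independence of counts to independence of sums. -/
lemma IsPoissonProcess.iIndepFun_pointSum {X : Type*} [MeasurableSpace X] {S : Ω → Set X}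
    {μ : Measure X} (hS : IsPoissonProcess S μ P) {ι : Type*} [Fintype ι] {D : ι → Set X}
    (hD : ∀ i, MeasurableSet (D i)) (hμ : ∀ i, μ (D i) < ∞)
    (hdisj : Pairwise (Function.onFun Disjoint D)) {g : X → ℝ} (hg : Measurable g) :
    iIndepFun (fun i ω => pointSum (S ω) (D i) g) P := by
  refine iIndepFun_of_integral_exp (fun i => hS.aemeasurable_pointSum (hD i) (hμ i) hg) fun θ => ?_
  have hUm : MeasurableSet (⋃ i, D i) := MeasurableSet.iUnion hD
  have hU : μ (⋃ i, D i) < ∞ :=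
    (measure_iUnion_fintype_le μ D).trans_lt (ENNReal.sum_lt_top.2 fun i _ => hμ i)
  have hfm : Measurable fun x => ∑ i, θ i * (D i).indicator g x :=
    Finset.measurable_sum _ fun i _ => (hg.indicator (hD i)).const_mul _
  have h1 : ∫ ω, Complex.exp ((∑ i, θ i * pointSum (S ω) (D i) g : ℝ) * Complex.I) ∂P =
      ∫ ω, Complex.exp (pointSum (S ω) (⋃ i, D i) (fun x => ∑ i, θ i * (D i).indicator g x) *
        Complex.I) ∂P := by
    refine integral_congr_ae ?_
    filter_upwards [hS.ae_finite hUm hU] with ω hω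
    have h2 : ∑ i, θ i * pointSum (S ω) (D i) g =
        pointSum (S ω) (⋃ i, D i) (fun x => ∑ i, θ i * (D i).indicator g x) := by
      rw [pointSum_eq_sum hω, Finset.sum_comm]
      refine Finset.sum_congr rfl fun i _ => ?_
      rw [pointSum_eq_sum_indicator hω (Set.subset_iUnion D i), Finset.mul_sum]
    rw [h2]
  have hint : ∀ {B : Set X}, μ B < ∞ → ∀ {f : X → ℝ}, Measurable f →
      IntegrableOn (fun x => Complex.exp (f x * Complex.I) - 1) B μ := by
    intro B hB f hf
    have : Fact (μ B < ∞) := ⟨hB⟩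
    refine Integrable.of_bound (C := 2) ?_ (ae_of_all _ fun x => (norm_sub_le _ _).trans ?_)
    · exact Measurable.aestronglyMeasurable (by fun_prop)
    · rw [Complex.norm_exp_ofReal_mul_I]; norm_num
  rw [h1, hS.integral_exp_pointSum hUm hU hfm,
    integral_iUnion_fintype hD hdisj fun i => hint (hμ i) hfm, Complex.exp_sum]
  refine Finset.prod_congr rfl fun i _ => ?_
  simp only [← pointSum_const_mul]
  rw [hS.integral_exp_pointSum (hD i) (hμ i) (hg.const_mul _)]
  congr 1
  refine setIntegral_congr_fun (hD i) fun x hx => ?_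
  have h2 : ∑ j, θ j * (D j).indicator g x = θ i * g x := by
    rw [Finset.sum_eq_single i, Set.indicator_of_mem hx]
    · intro j _ hj
      rw [Set.indicator_of_notMem (fun h => Set.disjoint_left.1 (hdisj hj) h hx), mul_zero]
    · simp
  simp only [h2]

end

/-! ### Exhausting rectangles and reflection in the second variable. -/

/-- The rectangle `E n × [-n, n]`. -/
def box (E : ℕ → Set ℝ) (n : ℕ) : Set (ℝ × ℝ) := E n ×ˢ Set.Icc (-(n : ℝ)) n

lemma partialSum_eq_pointSum (E : ℕ → Set ℝ) (g : ℝ × ℝ → ℝ) (S : Set (ℝ × ℝ)) (n : ℕ) :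
    partialSum E g S n = pointSum S (box E n) g := rfl

/-- A set of the plane that is symmetric under `(x, y) ↦ (x, -y)`. -/
def IsFlipInvariant (B : Set (ℝ × ℝ)) : Prop := ∀ x y, (x, -y) ∈ B ↔ (x, y) ∈ B

lemma isFlipInvariant_box (E : ℕ → Set ℝ) (n : ℕ) : IsFlipInvariant (box E n) := by
  intro x y
  simp only [box, Set.mem_prod, Set.mem_Icc, neg_le_neg_iff]
  constructor <;> rintro ⟨h1, h2, h3⟩ <;> refine ⟨h1, ?_, ?_⟩ <;> linarith

namespace IsExhaustion

variable {E : ℕ → Set ℝ} (hE : IsExhaustion E)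
include hE

lemma measurableSet_box (n : ℕ) : MeasurableSet (box E n) :=
  (hE.measurableSet n).prod measurableSet_Icc

lemma volume_box_lt_top (n : ℕ) : volume (box E n) < ∞ := by
  rw [box, Measure.volume_eq_prod, Measure.prod_prod]
  exact ENNReal.mul_lt_top (hE.volume_lt_top n) measure_Icc_lt_top

lemma monotone_box : Monotone (box E) := by
  intro m n hmn
  have h : (m : ℝ) ≤ n := by exact_mod_cast hmn
  exact Set.prod_mono (hE.mono hmn) (Set.Icc_subset_Icc (by linarith) h)

lemma eventually_mem_box (p : ℝ × ℝ) : ∀ᶠ n in atTop, p ∈ box E n := by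
  have h1 : p.1 ∈ ⋃ n, E n := hE.iUnion_eq ▸ Set.mem_univ _
  obtain ⟨m, hm⟩ := Set.mem_iUnion.1 h1
  obtain ⟨k, hk⟩ := exists_nat_ge |p.2|
  filter_upwards [eventually_ge_atTop m, eventually_ge_atTop k] with n hn hn'
  have h : (k : ℝ) ≤ n := by exact_mod_cast hn'
  exact ⟨hE.mono hn hm, abs_le.1 (hk.trans h)⟩

lemma iUnion_box : ⋃ n, box E n = Set.univ :=
  Set.eq_univ_of_forall fun p => Set.mem_iUnion.2 (hE.eventually_mem_box p).exists

lemma tendsto_partialSum_of_summable {S : Set (ℝ × ℝ)} {f : ℝ × ℝ → ℝ}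
    (hf : Summable fun p : ↥S => f p) :
    Tendsto (partialSum E f S) atTop (𝓝 (∑' p : ↥S, f p)) := by
  have h1 : partialSum E f S = fun n => ∑' p : ↥S, (box E n).indicator f p := by
    funext n
    rw [partialSum_eq_pointSum, pointSum_eq_tsum_indicator]
  rw [h1]
  refine tendsto_tsum_of_dominated_convergence hf.norm (fun p => ?_) (Eventually.of_forall
    fun n p => norm_indicator_le_norm_self _ _)
  refine tendsto_const_nhds.congr' ?_
  filter_upwards [hE.eventually_mem_box p] with n hn
  exact (Set.indicator_of_mem hn _).symm

end IsExhaustion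

lemma setIntegral_eq_zero_of_odd {f : ℝ × ℝ → ℝ} (hf : ∀ x y, f (x, -y) = -f (x, y))
    {B : Set (ℝ × ℝ)} (hB : IsFlipInvariant B) : ∫ p in B, f p = 0 := by
  have h0 : MeasurePreserving (fun p : ℝ × ℝ => (p.1, -p.2)) :=
    (MeasurePreserving.id volume).prod (Measure.measurePreserving_neg volume)
  have h1 := h0.setIntegral_preimage_emb
    (((MeasurableEquiv.refl ℝ).prodCongr (MeasurableEquiv.neg ℝ)).measurableEmbedding) f B
  have h2 : (fun p : ℝ × ℝ => (p.1, -p.2)) ⁻¹' B = B := by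
    ext p; exact hB p.1 p.2
  rw [h2] at h1
  simp only [hf, integral_neg] at h1
  linarith

/-! ### Odd kernels on symmetric sets: characteristic function and moments. -/

section

variable {Ω : Type*} [MeasurableSpace Ω] {P : Measure Ω} [IsProbabilityMeasure P]
  {S : Ω → Set (ℝ × ℝ)}

lemma integral_exp_pointSum_of_odd (hS : IsPoissonProcess S volume P)
    {B : Set (ℝ × ℝ)} (hB : MeasurableSet B) (hμ : volume B < ∞) (hBf : IsFlipInvariant B)
    {g : ℝ × ℝ → ℝ} (hg : Measurable g) (hodd : ∀ x y, g (x, -y) = -g (x, y)) :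
    ∫ ω, Complex.exp (pointSum (S ω) B g * Complex.I) ∂P =
      ((Real.exp (-∫ p in B, (1 - Real.cos (g p))) : ℝ) : ℂ) := by
  have : Fact (volume B < ∞) := ⟨hμ⟩
  rw [hS.integral_exp_pointSum hB hμ hg, Complex.ofReal_exp]
  congr 1
  have h1 : ∀ p, Complex.exp (g p * Complex.I) - 1 =
      ((-(1 - Real.cos (g p)) : ℝ) : ℂ) + ((Real.sin (g p) : ℝ) : ℂ) * Complex.I := by
    intro p
    rw [Complex.exp_mul_I]; push_cast; ring
  have i1 : IntegrableOn (fun p => -(1 - Real.cos (g p))) B := by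
    refine Integrable.of_bound (C := 2) (Measurable.aestronglyMeasurable (by fun_prop))
      (ae_of_all _ fun p => ?_)
    rw [norm_neg, Real.norm_eq_abs, abs_le]
    constructor <;> linarith [Real.cos_le_one (g p), Real.neg_one_le_cos (g p)]
  have i2 : IntegrableOn (fun p => Real.sin (g p)) B :=
    Integrable.of_bound (C := 1) (Measurable.aestronglyMeasurable (by fun_prop))
      (ae_of_all _ fun p => Real.abs_sin_le_one _)
  simp only [h1]
  rw [integral_add (Integrable.ofReal i1) ((Integrable.ofReal i2).mul_const _), integral_mul_const,
    integral_complex_ofReal, integral_complex_ofReal,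
    setIntegral_eq_zero_of_odd (f := fun p => Real.sin (g p)) (by simp [hodd]) hBf, integral_neg]
  simp

lemma integral_cos_pointSum_of_odd (hS : IsPoissonProcess S volume P)
    {B : Set (ℝ × ℝ)} (hB : MeasurableSet B) (hμ : volume B < ∞) (hBf : IsFlipInvariant B)
    {g : ℝ × ℝ → ℝ} (hg : Measurable g) (hodd : ∀ x y, g (x, -y) = -g (x, y)) :
    ∫ ω, Real.cos (pointSum (S ω) B g) ∂P = Real.exp (-∫ p in B, (1 - Real.cos (g p))) := by
  have h1 := congrArg Complex.re (integral_exp_pointSum_of_odd hS hB hμ hBf hg hodd)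
  rw [Complex.ofReal_re] at h1
  have hm := hS.aemeasurable_pointSum hB hμ hg
  rw [← h1]
  have hi : Integrable (fun ω => Complex.exp (pointSum (S ω) B g * Complex.I)) P := by
    refine Integrable.of_bound (C := 1) ?_
      (ae_of_all _ fun p => (Complex.norm_exp_ofReal_mul_I _).le)
    exact ((Complex.continuous_exp.comp (Complex.continuous_ofReal.mul
      continuous_const)).measurable.comp_aemeasurable hm).aestronglyMeasurable
  have h2 := integral_re hi
  simp only [RCLike.re_to_complex] at h2
  rw [← h2]
  simp [Complex.exp_mul_I, ← Complex.ofReal_cos, ← Complex.ofReal_sin]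

/-- The left side tends to `x²` as `t → 0`; writing it with `sinc` makes that limit a matter of
continuity. -/
lemma two_mul_one_sub_cos_eq (t x : ℝ) (ht : t ≠ 0) :
    2 / t ^ 2 * (1 - Real.cos (t * x)) = x ^ 2 * Real.sinc (t * x / 2) ^ 2 := by
  have h1 : Real.sin (t * x / 2) = t * x / 2 * Real.sinc (t * x / 2) := by
    by_cases h : t * x / 2 = 0
    · simp [h]
    · rw [Real.sinc_of_ne_zero h, mul_div_cancel₀ _ h]
  have h2 : 1 - Real.cos (t * x) = 2 * Real.sin (t * x / 2) ^ 2 := by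
    rw [Real.sin_sq_eq_half_sub]
    ring_nf
  rw [h2, h1]
  field_simp

lemma one_sub_cos_le_half_sq (x : ℝ) : 1 - Real.cos x ≤ x ^ 2 / 2 := by
  linarith [Real.one_sub_sq_div_two_le_cos (x := x)]

/-- The second moment comes from the characteristic function near `0`. The bounds `1 - e^{-I} ≤ I`
and `1 - cos x ≤ x²/2` give `2 t⁻² E(1 - cos tX) ≤ ∫ g²` uniformly in `t`, and Fatou's lemma lets `t
→ 0`. -/
lemma integrable_sq_pointSum (hS : IsPoissonProcess S volume P)
    {B : Set (ℝ × ℝ)} (hB : MeasurableSet B) (hμ : volume B < ∞) (hBf : IsFlipInvariant B)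
    {g : ℝ × ℝ → ℝ} (hg : Measurable g) (hodd : ∀ x y, g (x, -y) = -g (x, y))
    (hg2 : IntegrableOn (fun p => g p ^ 2) B) :
    Integrable (fun ω => pointSum (S ω) B g ^ 2) P ∧
      ∫ ω, pointSum (S ω) B g ^ 2 ∂P ≤ ∫ p in B, g p ^ 2 := by
  have hm := hS.aemeasurable_pointSum hB hμ hg
  have : Fact (volume B < ∞) := ⟨hμ⟩
  set X : Ω → ℝ := fun ω => pointSum (S ω) B g with hX
  set t : ℕ → ℝ := fun n => 1 / ((n : ℝ) + 1) with ht
  have htpos : ∀ n, t n ≠ 0 := fun n => by positivity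
  have htl : Tendsto t atTop (𝓝 0) := tendsto_one_div_add_atTop_nhds_zero_nat
  have hbound : ∀ n, ∫⁻ ω, ENNReal.ofReal (X ω ^ 2 * Real.sinc (t n * X ω / 2) ^ 2) ∂P ≤
      ENNReal.ofReal (∫ p in B, g p ^ 2) := by
    intro n
    have i1 : Integrable (fun ω => Real.cos (t n * X ω)) P :=
      Integrable.of_bound (C := 1) (Real.continuous_cos.measurable.comp_aemeasurable
        (hm.const_mul _)).aestronglyMeasurable (ae_of_all _ fun p => Real.abs_cos_le_one _)
    have i2 : IntegrableOn (fun p => 1 - Real.cos (t n * g p)) B := by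
      refine (integrable_const 1).sub (Integrable.of_bound (C := 1)
        (Measurable.aestronglyMeasurable (by fun_prop)) (ae_of_all _ fun p =>
        Real.abs_cos_le_one _))
    simp only [← two_mul_one_sub_cos_eq (t n) _ (htpos n)]
    have i3 : Integrable (fun ω => 2 / t n ^ 2 * (1 - Real.cos (t n * X ω))) P :=
      ((integrable_const 1).sub i1).const_mul _
    rw [← ofReal_integral_eq_lintegral_ofReal i3
      (ae_of_all _ fun ω => mul_nonneg (by positivity)
        (sub_nonneg.2 (Real.cos_le_one _)))]
    refine ENNReal.ofReal_le_ofReal ?_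
    have h3 := integral_cos_pointSum_of_odd hS hB hμ hBf (g := fun p => t n * g p)
      (hg.const_mul _) (fun x y => by simp [hodd])
    simp only [pointSum_const_mul] at h3
    rw [integral_const_mul, integral_sub (integrable_const 1) i1, h3]
    simp only [integral_const, probReal_univ, smul_eq_mul, mul_one]
    have h4 : ∫ p in B, (1 - Real.cos (t n * g p)) ≤ ∫ p in B, (t n) ^ 2 / 2 * g p ^ 2 := by
      refine integral_mono i2 (hg2.const_mul _) fun p => ?_
      refine (one_sub_cos_le_half_sq _).trans (le_of_eq ?_)
      ring
    rw [integral_const_mul] at h4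
    calc 2 / t n ^ 2 * (1 - Real.exp (-∫ p in B, (1 - Real.cos (t n * g p))))
        ≤ 2 / t n ^ 2 * (∫ p in B, (1 - Real.cos (t n * g p))) := by
          gcongr
          linarith [Real.add_one_le_exp (-∫ p in B, (1 - Real.cos (t n * g p)))]
      _ ≤ 2 / t n ^ 2 * ((t n) ^ 2 / 2 * ∫ p in B, g p ^ 2) := by gcongr
      _ = _ := by have := htpos n; field_simp
  have hlim : ∀ ω, Tendsto (fun n => ENNReal.ofReal (X ω ^ 2 * Real.sinc (t n * X ω / 2) ^ 2))
      atTop (𝓝 (ENNReal.ofReal (X ω ^ 2))) := by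
    intro ω
    refine (ENNReal.continuous_ofReal.tendsto _).comp ?_
    have h5 : Tendsto (fun n => t n * X ω / 2) atTop (𝓝 0) := by
      simpa using (htl.mul_const (X ω)).div_const 2
    have h6 := (((Real.continuous_sinc.tendsto 0).comp h5).pow 2).const_mul (X ω ^ 2)
    simpa using h6
  have hfin : ∫⁻ ω, ENNReal.ofReal (X ω ^ 2) ∂P ≤ ENNReal.ofReal (∫ p in B, g p ^ 2) := by
    calc ∫⁻ ω, ENNReal.ofReal (X ω ^ 2) ∂P
        = ∫⁻ ω, liminf (fun n => ENNReal.ofReal (X ω ^ 2 * Real.sinc (t n * X ω / 2) ^ 2))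
            atTop ∂P := lintegral_congr fun ω => (hlim ω).liminf_eq.symm
      _ ≤ liminf (fun n => ∫⁻ ω, ENNReal.ofReal (X ω ^ 2 * Real.sinc (t n * X ω / 2) ^ 2) ∂P)
            atTop := by
          refine lintegral_liminf_le' fun n => ?_
          exact ((hm.pow_const 2).mul ((Real.continuous_sinc.measurable.comp_aemeasurable
            ((hm.const_mul _).div_const 2)).pow_const 2)).ennreal_ofReal
      _ ≤ _ := liminf_le_of_frequently_le' (Frequently.of_forall hbound)
  have hint : Integrable (fun ω => X ω ^ 2) P := by
    refine ⟨(hm.pow_const 2).aestronglyMeasurable, ?_⟩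
    rw [hasFiniteIntegral_iff_ofReal (ae_of_all _ fun ω => sq_nonneg _)]
    exact hfin.trans_lt ENNReal.ofReal_lt_top
  refine ⟨hint, ?_⟩
  rw [← ofReal_integral_eq_lintegral_ofReal hint (ae_of_all _ fun ω => sq_nonneg _)] at hfin
  exact (ENNReal.ofReal_le_ofReal_iff (integral_nonneg fun p => sq_nonneg _)).1 hfin

/-- The characteristic function is even, so the sum and its negative have the same law.
Integrability is not needed, as the Bochner integral depends only on the law. -/
lemma integral_pointSum_eq_zero (hS : IsPoissonProcess S volume P)
    {B : Set (ℝ × ℝ)} (hB : MeasurableSet B) (hμ : volume B < ∞) (hBf : IsFlipInvariant B)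
    {g : ℝ × ℝ → ℝ} (hg : Measurable g) (hodd : ∀ x y, g (x, -y) = -g (x, y)) :
    ∫ ω, pointSum (S ω) B g ∂P = 0 := by
  have hm := hS.aemeasurable_pointSum hB hμ hg
  have h1 := identDistrib_of_integral_exp (P := P) (P' := P) (ι := Unit)
    (Z := fun _ ω => pointSum (S ω) B g) (Z' := fun _ ω => -pointSum (S ω) B g)
    (fun _ => hm) (fun _ => hm.neg) (fun θ => by
      have h2 := integral_exp_pointSum_of_odd hS hB hμ hBf (hg.const_mul (θ ()))
        (fun x y => by simp [hodd])
      have h3 := integral_exp_pointSum_of_odd hS hB hμ hBf (hg.const_mul (-θ ()))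
        (fun x y => by simp [hodd])
      simp only [pointSum_const_mul] at h2 h3
      simp only [Finset.univ_unique, Finset.sum_singleton]
      rw [show default = () from rfl, h2]
      simp only [neg_mul, Real.cos_neg] at h3
      simp only [mul_neg]
      exact h3.symm)
  have h4 := (h1.comp (measurable_pi_apply ())).integral_eq
  simp only [Function.comp, integral_neg] at h4
  change ∫ ω, pointSum (S ω) B g ∂P = -∫ ω, pointSum (S ω) B g ∂P at h4
  linarith

end

/-! ### The vector space of summable odd kernels. -/

/-- A measurable kernel on the plane, odd in the second variable, whose sum over a Poisson process
converges: `∫ min 1 g² < ∞`. -/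
structure IsSymmetricKernel (g : ℝ × ℝ → ℝ) : Prop where
  measurable : Measurable g
  odd : ∀ x y, g (x, -y) = -g (x, y)
  integrable : Integrable fun p => min 1 (g p ^ 2)

/-- Up to a factor `2` this is subadditivity, so `∫ min 1 g²` serves as a measure of size for
kernels. -/
lemma min_one_sq_add_le (a b : ℝ) :
    min 1 ((a + b) ^ 2) ≤ 2 * (min 1 (a ^ 2) + min 1 (b ^ 2)) := by
  rcases le_total 1 (a ^ 2) with h | h
  · rw [min_eq_left h]
    have : 0 ≤ min 1 (b ^ 2) := le_min zero_le_one (sq_nonneg _)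
    linarith [min_le_left 1 ((a + b) ^ 2)]
  · rcases le_total 1 (b ^ 2) with h' | h'
    · rw [min_eq_left h']
      have : 0 ≤ min 1 (a ^ 2) := le_min zero_le_one (sq_nonneg _)
      linarith [min_le_left 1 ((a + b) ^ 2)]
    · rw [min_eq_right h, min_eq_right h']
      refine (min_le_right _ _).trans ?_
      nlinarith [sq_nonneg (a - b)]

lemma min_one_sq_mul_le (c a : ℝ) :
    min 1 ((c * a) ^ 2) ≤ (1 + c ^ 2) * min 1 (a ^ 2) := by
  rcases le_total 1 (a ^ 2) with h | h
  · rw [min_eq_left h]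
    refine (min_le_left _ _).trans ?_
    nlinarith [sq_nonneg c]
  · rw [min_eq_right h]
    refine (min_le_right _ _).trans ?_
    nlinarith [sq_nonneg c, sq_nonneg a]

lemma min_one_sq_nonneg (a : ℝ) : 0 ≤ min 1 (a ^ 2) := le_min zero_le_one (sq_nonneg _)

lemma one_sub_cos_le (a : ℝ) : 1 - Real.cos a ≤ 2 * min 1 (a ^ 2) := by
  rcases le_total 1 (a ^ 2) with h | h
  · rw [min_eq_left h]; linarith [Real.neg_one_le_cos a]
  · rw [min_eq_right h]; linarith [one_sub_cos_le_half_sq a, sq_nonneg a]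

namespace IsSymmetricKernel

variable {g f : ℝ × ℝ → ℝ}

lemma of_le (hm : Measurable g) (ho : ∀ x y, g (x, -y) = -g (x, y)) {d : ℝ × ℝ → ℝ}
    (hd : Integrable d) (h : ∀ᵐ p, min 1 (g p ^ 2) ≤ d p) : IsSymmetricKernel g := by
  refine ⟨hm, ho, hd.mono' (Measurable.aestronglyMeasurable (by fun_prop)) ?_⟩
  filter_upwards [h] with p hp
  rwa [Real.norm_of_nonneg (min_one_sq_nonneg _)]

lemma add (hf : IsSymmetricKernel f) (hg : IsSymmetricKernel g) :
    IsSymmetricKernel fun p => f p + g p :=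
  of_le (hf.measurable.add hg.measurable) (fun x y => by rw [hf.odd, hg.odd]; ring)
    ((hf.integrable.add hg.integrable).const_mul 2) (ae_of_all _ fun _ => min_one_sq_add_le _ _)

lemma const_mul (hg : IsSymmetricKernel g) (c : ℝ) : IsSymmetricKernel fun p => c * g p :=
  of_le (hg.measurable.const_mul _) (fun x y => by rw [hg.odd]; ring)
    (hg.integrable.const_mul (1 + c ^ 2)) (ae_of_all _ fun _ => min_one_sq_mul_le _ _)

lemma sub (hf : IsSymmetricKernel f) (hg : IsSymmetricKernel g) :
    IsSymmetricKernel fun p => f p - g p := by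
  have := hf.add (hg.const_mul (-1))
  simpa only [neg_mul, one_mul, ← sub_eq_add_neg] using this

lemma sum {ι : Type*} {k : ι → ℝ × ℝ → ℝ} (s : Finset ι) (hk : ∀ i, IsSymmetricKernel (k i)) :
    IsSymmetricKernel fun p => ∑ i ∈ s, k i p := by
  classical
  induction s using Finset.induction_on with
  | empty => exact ⟨by simp, by simp, by simp⟩
  | insert i s hi ih => simp only [Finset.sum_insert hi]; exact (hk i).add ih

lemma integrable_one_sub_cos (hg : IsSymmetricKernel g) :
    Integrable fun p => 1 - Real.cos (g p) := by
  have := hg.measurable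
  refine (hg.integrable.const_mul 2).mono' (Measurable.aestronglyMeasurable (by fun_prop)) ?_
  refine ae_of_all _ fun p => ?_
  rw [Real.norm_of_nonneg (by linarith [Real.cos_le_one (g p)])]
  exact one_sub_cos_le _

end IsSymmetricKernel

/-! ### Convergence and law of the full Poisson sums. -/

section

variable {Ω : Type*} [MeasurableSpace Ω] {P : Measure Ω}
  {S : Ω → Set (ℝ × ℝ)} {E : ℕ → Set ℝ}

lemma ae_finite_box (hS : IsPoissonProcess S volume P) (hE : IsExhaustion E) :
    ∀ᵐ ω ∂P, ∀ n, (S ω ∩ box E n).Finite :=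
  ae_all_iff.2 fun n => hS.ae_finite (hE.measurableSet_box n) (hE.volume_box_lt_top n)

variable [IsProbabilityMeasure P]

/-- Convergence of the compensated small terms, by the martingale convergence theorem. -/
lemma ae_exists_tendsto_partialSum_of_sq (hS : IsPoissonProcess S volume P) (hE : IsExhaustion E)
    {h : ℝ × ℝ → ℝ} (hm : Measurable h) (hodd : ∀ x y, h (x, -y) = -h (x, y))
    (h2 : Integrable fun p => h p ^ 2) :
    ∀ᵐ ω ∂P, ∃ c, Tendsto (partialSum E h (S ω)) atTop (𝓝 c) := by
  -- The partial sums increase by sums over disjoint symmetric shells, which are independent and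
  -- centred.
  set D : ℕ → Set (ℝ × ℝ) := disjointed (box E) with hD
  have hDsub : ∀ k, D k ⊆ box E k := fun k => disjointed_subset _ k
  have hDm : ∀ k, MeasurableSet (D k) := fun k =>
    MeasurableSet.disjointed (fun n => hE.measurableSet_box n) k
  have hDfin : ∀ k, volume (D k) < ∞ := fun k =>
    (measure_mono (hDsub k)).trans_lt (hE.volume_box_lt_top k)
  have hDs : ∀ k, D (k + 1) = box E (k + 1) \ box E k := fun k => by
    have := hE.monotone_box.disjointed_succ (i := k) (by simp)
    simpa [hD] using this
  have hDf : ∀ k, IsFlipInvariant (D k) := by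
    intro k
    cases k with
    | zero => simpa [hD, disjointed_zero] using isFlipInvariant_box E 0
    | succ k =>
      intro x y
      rw [hDs, Set.mem_sdiff, Set.mem_sdiff, isFlipInvariant_box E _ x y, isFlipInvariant_box E _ x y]
  have hXm : ∀ k, AEMeasurable (fun ω => pointSum (S ω) (D k) h) P := fun k =>
    hS.aemeasurable_pointSum (hDm k) (hDfin k) hm
  -- A filtration requires genuinely measurable variables, so the shell sums are replaced by
  -- measurable versions.
  set ξ : ℕ → Ω → ℝ := fun k => (hXm k).mk _ with hξ
  have hξae : ∀ k, ξ k =ᵐ[P] fun ω => pointSum (S ω) (D k) h := fun k => (hXm k).ae_eq_mk.symm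
  have hξm : ∀ k, StronglyMeasurable (ξ k) := fun k => (hXm k).measurable_mk.stronglyMeasurable
  have hind : iIndepFun ξ P := by
    refine iIndepFun_iff_finset.2 fun s => ?_
    refine iIndepFun.congr (fun i => (hξae i).symm) (hS.iIndepFun_pointSum (D := fun i : s => D i)
      (fun i => hDm i) (fun i => hDfin i) (fun i j hij => ?_) hm)
    exact disjoint_disjointed (box E) (fun hij' => hij (Subtype.ext hij'))
  have hξ2 : ∀ k, Integrable (fun ω => ξ k ω ^ 2) P := fun k => by
    refine (integrable_sq_pointSum hS (hDm k) (hDfin k) (hDf k) hm hodd h2.integrableOn).1.congr ?_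
    filter_upwards [hξae k] with ω hω
    rw [hω]
  have hξ1 : ∀ k, Integrable (ξ k) P := fun k =>
    ((memLp_two_iff_integrable_sq (hξm k).aestronglyMeasurable).2 (hξ2 k)).integrable one_le_two
  have hξ0 : ∀ k, ∫ ω, ξ k ω ∂P = 0 := fun k => by
    rw [integral_congr_ae (hξae k)]
    exact integral_pointSum_eq_zero hS (hDm k) (hDfin k) (hDf k) hm hodd
  set M : ℕ → Ω → ℝ := fun n => ∑ k ∈ Finset.range (n + 1), ξ k with hM
  set ℱ := Filtration.natural ξ hξm with hℱ
  have hMint : ∀ n, Integrable (M n) P := fun n => integrable_finsetSum' _ fun k _ => hξ1 k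
  have hMad : StronglyAdapted ℱ M := by
    intro n
    refine Finset.stronglyMeasurable_sum _ fun k hk => ?_
    exact (Filtration.stronglyAdapted_natural hξm k).mono
      (ℱ.mono (Nat.lt_succ_iff.1 (Finset.mem_range.1 hk)))
  have hmart : Martingale M ℱ P := by
    refine martingale_nat hMad hMint fun i => ?_
    have e1 : M (i + 1) = M i + ξ (i + 1) := Finset.sum_range_succ _ _
    have e2 := condExp_add (hMint i) (hξ1 (i + 1)) (ℱ i)
    have e3 := iIndepFun.condExp_natural_ae_eq_of_lt hξm hind (Nat.lt_succ_self i)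
    have e4 := condExp_of_stronglyMeasurable (ℱ.le i) (hMad i) (hMint i)
    rw [e1]
    filter_upwards [e2, e3] with ω h3 h4
    rw [h3, Pi.add_apply, e4, h4, hξ0, add_zero]
  have hMae : ∀ᵐ ω ∂P, ∀ n, M n ω = partialSum E h (S ω) n := by
    filter_upwards [ae_all_iff.2 hξae, ae_finite_box hS hE] with ω h3 h4 n
    induction n with
    | zero =>
      simp only [hM, zero_add, Finset.range_one, Finset.sum_singleton, h3]
      rw [partialSum_eq_pointSum, hD, disjointed_zero]
    | succ n ih =>
      have e1 : M (n + 1) ω = M n ω + ξ (n + 1) ω := by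
        rw [show M (n + 1) = M n + ξ (n + 1) from Finset.sum_range_succ _ _, Pi.add_apply]
      rw [e1, ih, h3, partialSum_eq_pointSum, partialSum_eq_pointSum,
        pointSum_eq_sum_indicator (h4 (n + 1)) (hDsub _),
        pointSum_eq_sum_indicator (h4 (n + 1)) (hE.monotone_box n.le_succ),
        pointSum_eq_sum_indicator (h4 (n + 1)) subset_rfl, ← Finset.sum_add_distrib]
      refine Finset.sum_congr rfl fun p _ => ?_
      rw [hDs]
      have := congrFun (Set.indicator_self_add_compl (box E n) ((box E (n + 1)).indicator h)) p
      rw [Pi.add_apply, Set.indicator_indicator, Set.indicator_indicator,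
        Set.inter_eq_left.2 (hE.monotone_box n.le_succ), Set.inter_comm, ← Set.sdiff_eq] at this
      exact this
  -- The L¹ bound follows from the L² bound through `|M| ≤ 1 + M²`.
  have hbdd : ∀ n, eLpNorm (M n) 1 P ≤ ((1 + ∫ p, h p ^ 2).toNNReal : ℝ≥0∞) := by
    intro n
    rw [eLpNorm_one_eq_lintegral_enorm, ← ofReal_integral_norm_eq_lintegral_enorm (hMint n)]
    refine ENNReal.ofReal_le_ofReal ?_
    have h5 := integrable_sq_pointSum hS (hE.measurableSet_box n) (hE.volume_box_lt_top n)
      (isFlipInvariant_box E n) hm hodd h2.integrableOn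
    have h6 : ∫ ω, M n ω ^ 2 ∂P = ∫ ω, pointSum (S ω) (box E n) h ^ 2 ∂P := by
      refine integral_congr_ae ?_
      filter_upwards [hMae] with ω hω
      rw [hω]; rfl
    have h7 : Integrable (fun ω => M n ω ^ 2) P := by
      refine h5.1.congr ?_
      filter_upwards [hMae] with ω hω
      rw [hω]; rfl
    calc ∫ ω, ‖M n ω‖ ∂P ≤ ∫ ω, (1 + M n ω ^ 2) ∂P := by
          refine integral_mono (hMint n).norm ((integrable_const 1).add h7) fun ω => ?_
          simp only [Real.norm_eq_abs]
          nlinarith [sq_abs (M n ω), sq_nonneg (|M n ω| - 1), abs_nonneg (M n ω)]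
      _ = 1 + ∫ ω, M n ω ^ 2 ∂P := by rw [integral_add (integrable_const 1) h7]; simp
      _ ≤ 1 + ∫ p, h p ^ 2 := by
          rw [h6]
          have := setIntegral_le_integral (s := box E n) h2 (ae_of_all _ fun p => sq_nonneg (h p))
          linarith [h5.2]
  filter_upwards [hmart.submartingale.exists_ae_tendsto_of_bdd hbdd, hMae] with ω ⟨c, hc⟩ hω
  refine ⟨c, hc.congr hω⟩

lemma summable_indicator_of_finite {T A : Set (ℝ × ℝ)} (h : (T ∩ A).Finite) (g : ℝ × ℝ → ℝ) :
    Summable fun p : ↥T => A.indicator g p := by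
  refine summable_of_hasFiniteSupport ((h.preimage Subtype.val_injective.injOn).subset fun x hx => ?_)
  exact ⟨x.2, Set.mem_of_indicator_ne_zero hx⟩

lemma partialSum_add {T : Set (ℝ × ℝ)} (h : ∀ n, (T ∩ box E n).Finite) (f g : ℝ × ℝ → ℝ) :
    partialSum E (fun p => f p + g p) T = fun n => partialSum E f T n + partialSum E g T n :=
  funext fun n => pointSum_add (h n) f g

lemma partialSum_const_mul (T : Set (ℝ × ℝ)) (c : ℝ) (g : ℝ × ℝ → ℝ) :
    partialSum E (fun p => c * g p) T = fun n => c * partialSum E g T n :=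
  funext fun _ => pointSum_const_mul _ _ c g

namespace IsSymmetricKernel

variable {g f : ℝ × ℝ → ℝ}

lemma measure_large_lt_top (hg : IsSymmetricKernel g) : volume {p | 1 ≤ g p ^ 2} < ∞ := by
  convert! hg.integrable.measure_ge_lt_top one_pos using 3
  simp

lemma measurableSet_large (hg : IsSymmetricKernel g) : MeasurableSet {p | 1 ≤ g p ^ 2} :=
  measurableSet_le measurable_const (hg.measurable.pow_const 2)

/-- Split at `|g| = 1`. The region of large values has finite measure by Markov's inequality, so it
contains finitely many points; on the rest `g² = min 1 g²` is integrable and the martingale argument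
applies. -/
lemma sumConverges (hg : IsSymmetricKernel g) (hS : IsPoissonProcess S volume P)
    (hE : IsExhaustion E) : SumConverges S E g P := by
  set A : Set (ℝ × ℝ) := {p | 1 ≤ g p ^ 2} with hA
  have hAm : MeasurableSet A := hg.measurableSet_large
  have hAf : ∀ x y, (x, -y) ∈ A ↔ (x, y) ∈ A := by
    intro x y; simp [hA, hg.odd]
  have h1 := ae_exists_tendsto_partialSum_of_sq hS hE (h := Aᶜ.indicator g)
    (hg.measurable.indicator hAm.compl) (fun x y => by
      by_cases h : (x, y) ∈ A
      · rw [Set.indicator_of_notMem (by simpa [hAf] using h),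
          Set.indicator_of_notMem (by simpa using h), neg_zero]
      · rw [Set.indicator_of_mem (by simpa [hAf] using h),
          Set.indicator_of_mem (by simpa using h), hg.odd]) (by
      refine hg.integrable.mono' ((hg.measurable.indicator
        hAm.compl).pow_const 2).aestronglyMeasurable (ae_of_all _ fun p => ?_)
      rw [Real.norm_of_nonneg (sq_nonneg _)]
      by_cases h : p ∈ A
      · rw [Set.indicator_of_notMem (by simpa using h)]
        simpa using min_one_sq_nonneg _
      · rw [Set.indicator_of_mem (by simpa using h), min_eq_right]
        exact (not_le.1 h).le)
  filter_upwards [h1, hS.ae_finite hAm hg.measure_large_lt_top, ae_finite_box hS hE]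
    with ω ⟨c, hc⟩ hfin hbox
  have h2 := hE.tendsto_partialSum_of_summable (summable_indicator_of_finite hfin g)
  have h3 := h2.add hc
  rw [← partialSum_add hbox] at h3
  have h4 : (fun p => A.indicator g p + Aᶜ.indicator g p) = g :=
    funext fun p => Set.indicator_self_add_compl_apply A g p
  rw [h4] at h3
  exact tendsto_nhds_limUnder ⟨_, h3⟩

end IsSymmetricKernel

lemma poissonSum_add {T : Set (ℝ × ℝ)} (h : ∀ n, (T ∩ box E n).Finite) {f g : ℝ × ℝ → ℝ}
    (hf : Tendsto (partialSum E f T) atTop (𝓝 (poissonSum E f T)))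
    (hg : Tendsto (partialSum E g T) atTop (𝓝 (poissonSum E g T))) :
    poissonSum E (fun p => f p + g p) T = poissonSum E f T + poissonSum E g T := by
  refine Tendsto.limUnder_eq ?_
  rw [partialSum_add h]
  exact hf.add hg

lemma poissonSum_const_mul {T : Set (ℝ × ℝ)} {g : ℝ × ℝ → ℝ}
    (hg : Tendsto (partialSum E g T) atTop (𝓝 (poissonSum E g T))) (c : ℝ) :
    poissonSum E (fun p => c * g p) T = c * poissonSum E g T := by
  refine Tendsto.limUnder_eq ?_
  rw [partialSum_const_mul]
  exact hg.const_mul c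

namespace IsSymmetricKernel

variable {g f : ℝ × ℝ → ℝ}

lemma ae_poissonSum_add (hf : IsSymmetricKernel f) (hg : IsSymmetricKernel g)
    (hS : IsPoissonProcess S volume P) (hE : IsExhaustion E) :
    ∀ᵐ ω ∂P, poissonSum E (fun p => f p + g p) (S ω) =
      poissonSum E f (S ω) + poissonSum E g (S ω) := by
  filter_upwards [hf.sumConverges hS hE, hg.sumConverges hS hE, ae_finite_box hS hE] with ω h1 h2 h3
  exact poissonSum_add h3 h1 h2

lemma ae_poissonSum_const_mul (hg : IsSymmetricKernel g)
    (hS : IsPoissonProcess S volume P) (hE : IsExhaustion E) (c : ℝ) :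
    ∀ᵐ ω ∂P, poissonSum E (fun p => c * g p) (S ω) = c * poissonSum E g (S ω) := by
  filter_upwards [hg.sumConverges hS hE] with ω h1
  exact poissonSum_const_mul h1 c

lemma ae_poissonSum_sub (hf : IsSymmetricKernel f) (hg : IsSymmetricKernel g)
    (hS : IsPoissonProcess S volume P) (hE : IsExhaustion E) :
    ∀ᵐ ω ∂P, poissonSum E (fun p => f p - g p) (S ω) =
      poissonSum E f (S ω) - poissonSum E g (S ω) := by
  filter_upwards [hf.ae_poissonSum_add (hg.const_mul (-1)) hS hE,
    hg.ae_poissonSum_const_mul hS hE (-1)] with ω h1 h2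
  rw [h2] at h1
  simpa only [neg_mul, one_mul, ← sub_eq_add_neg] using h1

lemma ae_poissonSum_sum {ι : Type*} [Fintype ι] {k : ι → ℝ × ℝ → ℝ}
    (hk : ∀ i, IsSymmetricKernel (k i)) (hS : IsPoissonProcess S volume P) (hE : IsExhaustion E)
    (θ : ι → ℝ) :
    ∀ᵐ ω ∂P, poissonSum E (fun p => ∑ i, θ i * k i p) (S ω) =
      ∑ i, θ i * poissonSum E (k i) (S ω) := by
  have h1 : ∀ᵐ ω ∂P, ∀ i, Tendsto (partialSum E (k i) (S ω)) atTop
    (𝓝 (poissonSum E (k i) (S ω))) := ae_all_iff.2 fun i => (hk i).sumConverges hS hE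
  filter_upwards [h1, ae_finite_box hS hE] with ω h2 h3
  refine Tendsto.limUnder_eq ?_
  have h4 : partialSum E (fun p => ∑ i, θ i * k i p) (S ω) =
      fun n => ∑ i, θ i * partialSum E (k i) (S ω) n := by
    funext n
    simp only [partialSum_eq_pointSum, pointSum_eq_sum (h3 n), Finset.mul_sum]
    exact Finset.sum_comm
  rw [h4]
  exact tendsto_finsetSum _ fun i _ => (h2 i).const_mul _

lemma aemeasurable_poissonSum (hg : IsSymmetricKernel g)
    (hS : IsPoissonProcess S volume P) (hE : IsExhaustion E) :
    AEMeasurable (fun ω => poissonSum E g (S ω)) P :=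
  aemeasurable_of_tendsto_metrizable_ae atTop (fun n => hS.aemeasurable_pointSum
    (hE.measurableSet_box n) (hE.volume_box_lt_top n) hg.measurable) (hg.sumConverges hS hE)

lemma integral_exp_poissonSum (hg : IsSymmetricKernel g)
    (hS : IsPoissonProcess S volume P) (hE : IsExhaustion E) :
    ∫ ω, Complex.exp (poissonSum E g (S ω) * Complex.I) ∂P =
      ((Real.exp (-∫ p, (1 - Real.cos (g p))) : ℝ) : ℂ) := by
  have hcont : Continuous fun x : ℝ => Complex.exp (x * Complex.I) := by fun_prop
  have h1 : Tendsto (fun n => ∫ ω, Complex.exp (pointSum (S ω) (box E n) g * Complex.I) ∂P) atTop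
      (𝓝 (∫ ω, Complex.exp (poissonSum E g (S ω) * Complex.I) ∂P)) := by
    refine tendsto_integral_of_dominated_convergence (fun _ => 1) (fun n => ?_)
      (integrable_const _) (fun n => ?_) ?_
    · exact (hcont.measurable.comp_aemeasurable (hS.aemeasurable_pointSum
        (hE.measurableSet_box n) (hE.volume_box_lt_top n) hg.measurable)).aestronglyMeasurable
    · exact ae_of_all _ fun ω => (Complex.norm_exp_ofReal_mul_I _).le
    · filter_upwards [hg.sumConverges hS hE] with ω hω
      exact (hcont.tendsto _).comp hω
  have h2 : Tendsto (fun n => ∫ p in box E n, (1 - Real.cos (g p))) atTop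
      (𝓝 (∫ p, (1 - Real.cos (g p)))) := by
    have := tendsto_setIntegral_of_monotone (μ := volume) (f := fun p => 1 - Real.cos (g p))
      (fun n => hE.measurableSet_box n) hE.monotone_box hg.integrable_one_sub_cos.integrableOn
    rwa [hE.iUnion_box, setIntegral_univ] at this
  simp only [integral_exp_pointSum_of_odd hS (hE.measurableSet_box _) (hE.volume_box_lt_top _)
    (isFlipInvariant_box E _) hg.measurable hg.odd] at h1
  refine tendsto_nhds_unique h1 ((Complex.continuous_ofReal.tendsto _).comp
    ((Real.continuous_exp.tendsto _).comp h2.neg))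

lemma integral_exp_sum (hS : IsPoissonProcess S volume P) (hE : IsExhaustion E)
    {ι : Type*} [Fintype ι] {k : ι → ℝ × ℝ → ℝ} (hk : ∀ i, IsSymmetricKernel (k i)) (θ : ι → ℝ) :
    ∫ ω, Complex.exp ((∑ i, θ i * poissonSum E (k i) (S ω) : ℝ) * Complex.I) ∂P =
      ((Real.exp (-∫ p, (1 - Real.cos (∑ i, θ i * k i p))) : ℝ) : ℂ) := by
  rw [← (IsSymmetricKernel.sum Finset.univ fun i =>
    (hk i).const_mul (θ i)).integral_exp_poissonSum hS hE]
  refine integral_congr_ae ?_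
  filter_upwards [ae_poissonSum_sum hk hS hE θ] with ω hω
  rw [hω]

lemma integral_exp_mul (hg : IsSymmetricKernel g)
    (hS : IsPoissonProcess S volume P) (hE : IsExhaustion E) (θ : ℝ) :
    ∫ ω, Complex.exp ((θ * poissonSum E g (S ω) : ℝ) * Complex.I) ∂P =
      ((Real.exp (-∫ p, (1 - Real.cos (θ * g p))) : ℝ) : ℂ) := by
  have := integral_exp_sum hS hE (fun _ : Unit => hg) (fun _ => θ)
  simpa using this

lemma charFun_map_poissonSum (hg : IsSymmetricKernel g)
    (hS : IsPoissonProcess S volume P) (hE : IsExhaustion E) (θ : ℝ) :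
    charFun (P.map fun ω => poissonSum E g (S ω)) θ =
      ((Real.exp (-∫ p, (1 - Real.cos (θ * g p))) : ℝ) : ℂ) := by
  rw [charFun_apply_real, integral_map (hg.aemeasurable_poissonSum hS hE) (by fun_prop),
    ← hg.integral_exp_mul hS hE]
  simp

/-- Additivity of the exponent is factorisation of the joint characteristic function. -/
lemma iIndepFun_poissonSum (hS : IsPoissonProcess S volume P) (hE : IsExhaustion E)
    {ι : Type*} [Fintype ι] {k : ι → ℝ × ℝ → ℝ} (hk : ∀ i, IsSymmetricKernel (k i))
    (h : ∀ θ : ι → ℝ, ∫ p, (1 - Real.cos (∑ i, θ i * k i p)) =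
      ∑ i, ∫ p, (1 - Real.cos (θ i * k i p))) :
    iIndepFun (fun i ω => poissonSum E (k i) (S ω)) P := by
  refine iIndepFun_of_integral_exp (fun i => (hk i).aemeasurable_poissonSum hS hE) fun θ => ?_
  rw [integral_exp_sum hS hE hk, h]
  simp only [fun i => (hk i).integral_exp_mul hS hE (θ i)]
  rw [← Finset.sum_neg_distrib, Real.exp_sum, Complex.ofReal_prod]

lemma identDistrib_poissonSum (hS : IsPoissonProcess S volume P) (hE : IsExhaustion E)
    {ι : Type*} [Fintype ι] {k l : ι → ℝ × ℝ → ℝ} (hk : ∀ i, IsSymmetricKernel (k i))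
    (hl : ∀ i, IsSymmetricKernel (l i))
    (h : ∀ θ : ι → ℝ, ∫ p, (1 - Real.cos (∑ i, θ i * k i p)) =
      ∫ p, (1 - Real.cos (∑ i, θ i * l i p))) :
    IdentDistrib (fun ω i => poissonSum E (k i) (S ω)) (fun ω i => poissonSum E (l i) (S ω))
      P P := by
  refine identDistrib_of_integral_exp (fun i => (hk i).aemeasurable_poissonSum hS hE)
    (fun i => (hl i).aemeasurable_poissonSum hS hE) fun θ => ?_
  rw [integral_exp_sum hS hE hk, integral_exp_sum hS hE hl, h]

/-- The tail is at most `ε/2` times the norm of the integral of `1 - φ` over `[-2/ε, 2/ε]`, where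
`φ` is the characteristic function, and `1 - φ(t) ≤ ∫ (1 - cos (t g)) ≤ 2 (1 + t²) ∫ min 1 g²`. The
interval has length `4/ε`, whence the constant. -/
lemma measureReal_lt_abs_poissonSum_le (hg : IsSymmetricKernel g)
    (hS : IsPoissonProcess S volume P) (hE : IsExhaustion E) {ε : ℝ} (hε : 0 < ε) :
    P.real {ω | ε < |poissonSum E g (S ω)|} ≤
      4 * (1 + (2 * ε⁻¹) ^ 2) * ∫ p, min 1 (g p ^ 2) := by
  have hm := hg.aemeasurable_poissonSum hS hE
  have := Measure.isProbabilityMeasure_map hm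
  have h1 := measureReal_abs_gt_le_integral_charFun
    (μ := P.map fun ω => poissonSum E g (S ω)) hε
  rw [map_measureReal_apply_of_aemeasurable hm
    (measurableSet_lt measurable_const continuous_abs.measurable)] at h1
  refine h1.trans ?_
  set Q := ∫ p, min 1 (g p ^ 2)
  have h2 : ∀ t ∈ Set.uIoc (-2 * ε⁻¹) (2 * ε⁻¹),
      ‖1 - charFun (P.map fun ω => poissonSum E g (S ω)) t‖ ≤ 2 * (1 + (2 * ε⁻¹) ^ 2) * Q := by
    intro t ht
    rw [hg.charFun_map_poissonSum hS hE, ← Complex.ofReal_one, ← Complex.ofReal_sub,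
      Complex.norm_real]
    have h3 : 0 ≤ ∫ p, (1 - Real.cos (t * g p)) :=
      integral_nonneg fun p => sub_nonneg.2 (Real.cos_le_one _)
    rw [Real.norm_of_nonneg (sub_nonneg.2 (Real.exp_le_one_iff.2 (by linarith)))]
    have h4 : ∫ p, (1 - Real.cos (t * g p)) ≤ ∫ p, 2 * (1 + (2 * ε⁻¹) ^ 2) * min 1 (g p ^ 2) := by
      refine integral_mono (hg.const_mul t).integrable_one_sub_cos (hg.integrable.const_mul _)
        fun p => ?_
      refine (one_sub_cos_le _).trans ?_
      have h5 := min_one_sq_mul_le t (g p)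
      have h6 : t ^ 2 ≤ (2 * ε⁻¹) ^ 2 := by
        rw [Set.uIoc_of_le (by have := inv_pos.2 hε; linarith)] at ht
        exact sq_le_sq' (by linarith [ht.1]) ht.2
      have h7 := min_one_sq_nonneg (g p)
      nlinarith
    rw [integral_const_mul] at h4
    linarith [Real.add_one_le_exp (-∫ p, (1 - Real.cos (t * g p)))]
  have h8 := intervalIntegral.norm_integral_le_of_norm_le_const h2
  have h9 : |2 * ε⁻¹ - -2 * ε⁻¹| = 4 * ε⁻¹ := by
    rw [abs_of_nonneg] <;> have := inv_pos.2 hε <;> linarith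
  rw [h9] at h8
  calc _ ≤ 2⁻¹ * ε * (2 * (1 + (2 * ε⁻¹) ^ 2) * Q * (4 * ε⁻¹)) := by gcongr
    _ = _ := by field_simp

lemma tendstoInMeasure_poissonSum {ι : Type*} {l : Filter ι} {k : ι → ℝ × ℝ → ℝ}
    (hS : IsPoissonProcess S volume P) (hE : IsExhaustion E) (hk : ∀ i, IsSymmetricKernel (k i))
    (h : Tendsto (fun i => ∫ p, min 1 (k i p ^ 2)) l (𝓝 0)) :
    TendstoInMeasure P (fun i ω => poissonSum E (k i) (S ω)) l 0 := by
  rw [tendstoInMeasure_iff_measureReal_norm]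
  intro ε hε
  -- The tail bound concerns a strict inequality, so it is used at `ε / 2`.
  have h1 : Tendsto (fun i => 4 * (1 + (2 * (ε / 2)⁻¹) ^ 2) * ∫ p, min 1 (k i p ^ 2)) l (𝓝 0) := by
    simpa using h.const_mul (4 * (1 + (2 * (ε / 2)⁻¹) ^ 2))
  refine squeeze_zero (fun _ => measureReal_nonneg) (fun i => ?_) h1
  refine le_trans (measureReal_mono fun ω hω => ?_)
    ((hk i).measureReal_lt_abs_poissonSum_le hS hE (half_pos hε))
  simp only [Set.mem_ofPred_eq, Pi.zero_apply, sub_zero, Real.norm_eq_abs] at hω ⊢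
  linarith

/-- A null sum has characteristic function `1`, which forces `cos (g / (n + 1)) = 1` almost
everywhere for every `n`. Once `n > |g|` the argument lies within `(-2π, 2π)` and must vanish. -/
lemma ae_eq_zero_of_poissonSum (hg : IsSymmetricKernel g)
    (hS : IsPoissonProcess S volume P) (hE : IsExhaustion E)
    (h : ∀ᵐ ω ∂P, poissonSum E g (S ω) = 0) : ∀ᵐ p, g p = 0 := by
  have h1 : ∀ n : ℕ, ∀ᵐ p, Real.cos (((n : ℝ) + 1)⁻¹ * g p) = 1 := by
    intro n
    have h2 := hg.integral_exp_mul hS hE ((n : ℝ) + 1)⁻¹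
    have h3 : ∫ ω, Complex.exp (((((n : ℝ) + 1)⁻¹ * poissonSum E g (S ω) : ℝ) : ℂ) * Complex.I) ∂P
        = 1 := by
      rw [integral_congr_ae (g := fun _ => (1 : ℂ)) (by filter_upwards [h] with ω hω; simp [hω])]
      simp
    rw [h3] at h2
    have h4 : Real.exp (-∫ p, (1 - Real.cos (((n : ℝ) + 1)⁻¹ * g p))) = 1 := by
      exact_mod_cast h2.symm
    rw [Real.exp_eq_one_iff, neg_eq_zero, integral_eq_zero_iff_of_nonneg
      (fun p => sub_nonneg.2 (Real.cos_le_one _))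
      (hg.const_mul _).integrable_one_sub_cos] at h4
    filter_upwards [h4] with p hp
    simp only [Pi.zero_apply] at hp
    linarith
  filter_upwards [ae_all_iff.2 h1] with p hp
  obtain ⟨n, hn⟩ := exists_nat_gt |g p|
  have hn0 : (0 : ℝ) < (n : ℝ) + 1 := by positivity
  have h5 : |((n : ℝ) + 1)⁻¹ * g p| < 1 := by
    rw [abs_mul, abs_of_pos (inv_pos.2 hn0), inv_mul_lt_iff₀ hn0]
    linarith
  have h6 := (Real.cos_eq_one_iff_of_lt_of_lt (by linarith [(abs_lt.1 h5).1, Real.pi_gt_three])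
    (by linarith [(abs_lt.1 h5).2, Real.pi_gt_three])).1 (hp n)
  rcases mul_eq_zero.1 h6 with h7 | h7
  · exact absurd h7 (inv_pos.2 hn0).ne'
  · exact h7

end IsSymmetricKernel

end

/-! ### Campbell's formula and absolute convergence. -/

lemma lintegral_natCast_poissonMeasure (r : NNReal) :
    ∫⁻ k : ℕ, (k : ℝ≥0∞) ∂poissonMeasure r = r := by
  rw [lintegral_countable', tsum_eq_zero_add' ENNReal.summable]
  simp only [Nat.cast_zero, zero_mul, zero_add]
  have h : ∀ k : ℕ, ((k + 1 : ℕ) : ℝ≥0∞) * poissonMeasure r {k + 1} =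
      r * poissonMeasure r {k} := by
    intro k
    rw [poissonMeasure_singleton, poissonMeasure_singleton, ← ENNReal.ofReal_natCast,
      ← ENNReal.ofReal_coe_nnreal (p := r), ← ENNReal.ofReal_mul (by positivity),
      ← ENNReal.ofReal_mul (by positivity)]
    congr 1
    rw [Nat.factorial_succ]
    push_cast
    field_simp
    ring
  simp only [h]
  rw [ENNReal.tsum_mul_left]
  have h1 := measure_univ (μ := poissonMeasure r)
  rw [← lintegral_one, lintegral_countable'] at h1
  simp only [one_mul] at h1
  rw [h1, mul_one]

/-- The counting measure of a set of points. -/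
noncomputable def pointMeasure {X : Type*} [MeasurableSpace X] (T : Set X) : Measure X :=
  Measure.sum fun p : ↥T => Measure.dirac (p : X)

section

variable {Ω X : Type*} [MeasurableSpace Ω] [MeasurableSpace X] {P : Measure Ω}
  {S : Ω → Set X} {μ : Measure X}

lemma pointMeasure_apply (T : Set X) {A : Set X} (hA : MeasurableSet A) :
    pointMeasure T A = (T ∩ A).encard := by
  rw [pointMeasure, Measure.sum_apply _ hA, ← ENNReal.tsum_set_one]
  simp only [Measure.dirac_apply' _ hA]
  rw [tsum_subtype T (A.indicator 1), tsum_subtype (T ∩ A) (fun _ => (1 : ℝ≥0∞)),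
    Set.indicator_indicator]
  rfl

lemma lintegral_pointMeasure (T : Set X) {g : X → ℝ≥0∞} (hg : Measurable g) :
    ∫⁻ x, g x ∂pointMeasure T = ∑' p : ↥T, g p := by
  rw [pointMeasure, lintegral_sum_measure]
  simp only [lintegral_dirac' _ hg]

lemma IsPoissonProcess.measurable_pointMeasure (hS : IsPoissonProcess S μ P) :
    Measurable fun ω => pointMeasure (S ω) := by
  refine Measure.measurable_of_measurable_coe _ fun A hA => ?_
  simp only [pointMeasure_apply _ hA]
  exact (measurable_of_countable (fun k : ℕ∞ => (k : ℝ≥0∞))).comp (hS.measurable_count A hA)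

/-- Campbell's formula. -/
lemma IsPoissonProcess.lintegral_tsum [IsProbabilityMeasure P] (hS : IsPoissonProcess S μ P)
    {g : X → ℝ≥0∞} (hg : Measurable g) :
    ∫⁻ ω, ∑' p : ↥(S ω), g p ∂P = ∫⁻ x, g x ∂μ := by
  have hM := hS.measurable_pointMeasure
  -- The mean of the random counting measure is `μ`; sets of infinite measure are handled by
  -- `count_eq_top`.
  have h1 : P.bind (fun ω => pointMeasure (S ω)) = μ := by
    ext A hA
    rw [Measure.bind_apply hA hM.aemeasurable]
    simp only [pointMeasure_apply _ hA]
    by_cases h : μ A = ∞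
    · rw [h, lintegral_congr_ae (g := fun _ => ∞)
        (by filter_upwards [hS.count_eq_top A hA h] with ω hω; simp [hω])]
      simp
    · have hm : Measurable fun k : ℕ∞ => (k : ℝ≥0∞) := measurable_of_countable _
      have hlt : μ A < ∞ := lt_top_iff_ne_top.2 h
      rw [← lintegral_map (f := fun k : ℕ∞ => (k : ℝ≥0∞)) hm (hS.measurable_count A hA),
        hS.law_count A hA hlt, lintegral_map hm (by fun_prop)]
      simp only [ENat.toENNReal_coe]
      rw [lintegral_natCast_poissonMeasure, ENNReal.coe_toNNReal h]
  conv_rhs => rw [← h1]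
  rw [Measure.lintegral_bind hM.aemeasurable hg.aemeasurable]
  simp only [lintegral_pointMeasure _ hg]

end

/-- Again split at `|g| = 1`: finitely many points carry large values, and for the others Campbell's
formula gives the sum of `|g|` a finite mean. -/
lemma sumConvergesAbsolutely_of_integrable {Ω : Type*} [MeasurableSpace Ω] {P : Measure Ω}
    [IsProbabilityMeasure P] {S : Ω → Set (ℝ × ℝ)} {E : ℕ → Set ℝ}
    (hS : IsPoissonProcess S volume P) (hE : IsExhaustion E) {g : ℝ × ℝ → ℝ}
    (hg : Measurable g) (hi : Integrable fun p => min 1 |g p|) :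
    SumConvergesAbsolutely S E g P := by
  set A : Set (ℝ × ℝ) := {p | 1 ≤ |g p|} with hA
  have hAm : MeasurableSet A := measurableSet_le measurable_const hg.abs
  have hAlt : volume A < ∞ := by
    convert! hi.measure_ge_lt_top one_pos using 3
    simp
  have hm : Measurable (Aᶜ.indicator g) := hg.indicator hAm.compl
  have hint : Integrable (Aᶜ.indicator g) := by
    refine hi.mono' hm.aestronglyMeasurable (ae_of_all _ fun p => ?_)
    by_cases h : p ∈ A
    · rw [Set.indicator_of_notMem (by simpa using h), norm_zero]
      exact le_min zero_le_one (abs_nonneg _)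
    · rw [Set.indicator_of_mem (by simpa using h), min_eq_right (not_le.1 h).le,
        Real.norm_eq_abs]
  have h1 := hS.lintegral_tsum (g := fun p => ‖Aᶜ.indicator g p‖ₑ) hm.enorm
  have hM : Measurable fun ω => ∑' p : ↥(S ω), ‖Aᶜ.indicator g p‖ₑ := by
    have := (Measure.measurable_lintegral hm.enorm).comp hS.measurable_pointMeasure
    simpa only [Function.comp_def, lintegral_pointMeasure _ hm.enorm] using this
  have h2 := ae_lt_top hM (by rw [h1]; exact hint.2.ne)
  filter_upwards [h2, hS.ae_finite hAm hAlt] with ω h3 h4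
  have h5 : Summable fun p : ↥(S ω) => Aᶜ.indicator g p := by
    refine Summable.of_enorm h3.ne
  have h6 := (summable_indicator_of_finite h4 g).add h5
  simp only [Set.indicator_self_add_compl_apply] at h6
  have h7 := hE.tendsto_partialSum_of_summable h6
  rw [poissonSum, h7.limUnder_eq]
  exact h6.hasSum

/-! ### The integral that determines the stable constant. -/

/-- Tonelli's theorem for Bochner integrals: with integrable slices both sides are `toReal` of one
lower integral, even if infinite, so joint integrability is not needed. -/
lemma integral_Ioi_swap_of_nonneg {F : ℝ → ℝ → ℝ} (hF : Measurable (Function.uncurry F))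
    (h0 : ∀ x, 0 < x → ∀ y, 0 < y → 0 ≤ F x y)
    (h1 : ∀ x, 0 < x → IntegrableOn (F x) (Set.Ioi 0))
    (h2 : ∀ y, 0 < y → IntegrableOn (fun x => F x y) (Set.Ioi 0)) :
    ∫ x in Set.Ioi 0, ∫ y in Set.Ioi 0, F x y = ∫ y in Set.Ioi 0, ∫ x in Set.Ioi 0, F x y := by
  have key : ∀ {G : ℝ → ℝ → ℝ}, Measurable (Function.uncurry G) →
      (∀ x, 0 < x → ∀ y, 0 < y → 0 ≤ G x y) → (∀ x, 0 < x → IntegrableOn (G x) (Set.Ioi 0)) →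
      ∫ x in Set.Ioi 0, ∫ y in Set.Ioi 0, G x y =
        (∫⁻ x in Set.Ioi 0, ∫⁻ y in Set.Ioi 0, ENNReal.ofReal (G x y)).toReal := by
    intro G hG h0 h1
    rw [integral_eq_lintegral_of_nonneg_ae]
    · congr 1
      refine setLIntegral_congr_fun measurableSet_Ioi fun x hx => ?_
      exact ofReal_integral_eq_lintegral_ofReal (h1 x hx)
        ((ae_restrict_iff' measurableSet_Ioi).2 (ae_of_all _ fun y hy => h0 x hx y hy))
    · exact (ae_restrict_iff' measurableSet_Ioi).2 (ae_of_all _ fun x hx =>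
        setIntegral_nonneg measurableSet_Ioi fun y hy => h0 x hx y hy)
    · exact (hG.stronglyMeasurable.integral_prod_right
        (ν := volume.restrict (Set.Ioi (0 : ℝ)))).aestronglyMeasurable
  have hF' : Measurable (Function.uncurry fun y x => F x y) := hF.comp measurable_swap
  rw [key hF h0 h1, key hF' (fun y hy x hx => h0 x hx y hy) h2, lintegral_lintegral_swap]
  exact hF.ennreal_ofReal.aemeasurable

/-- `∫₀^∞ s^{b-1} / (1 + s²) ds = Γ(b/2) Γ(1 - b/2) / 2`. -/
lemma integral_rpow_div_one_add_sq {b : ℝ} (hb : 0 < b) (hb2 : b < 2) :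
    ∫ s in Set.Ioi 0, s ^ (b - 1) / (1 + s ^ 2) =
      Real.Gamma (b / 2) * Real.Gamma (1 - b / 2) / 2 := by
  -- Since `1 / (1 + s²) = ∫ exp(-(1 + s²) v) dv`, exchanging the integrals leaves a Gaussian moment
  -- and then a Gamma integral.
  set F : ℝ → ℝ → ℝ := fun s v => s ^ (b - 1) * Real.exp (-(1 + s ^ 2) * v) with hF
  have hFm : Measurable (Function.uncurry F) := by
    simp only [hF]; unfold Function.uncurry; fun_prop
  have e1 : ∀ s, 0 < s → ∫ v in Set.Ioi 0, F s v = s ^ (b - 1) / (1 + s ^ 2) := by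
    intro s hs
    simp only [hF]
    rw [integral_const_mul, integral_exp_mul_Ioi (by nlinarith)]
    simp only [mul_zero, Real.exp_zero, neg_div_neg_eq, mul_one_div]
  have e2 : ∀ v, 0 < v → ∫ s in Set.Ioi 0, F s v =
      Real.Gamma (b / 2) / 2 * (v ^ (1 - b / 2 - 1) * Real.exp (-(1 * v))) := by
    intro v hv
    have h1 := integral_rpow_mul_exp_neg_mul_rpow (p := 2) (q := b - 1) (b := v) two_pos
      (by linarith) hv
    have h2 : ∀ s, F s v = Real.exp (-(1 * v)) * (s ^ (b - 1) * Real.exp (-v * s ^ (2 : ℝ))) := by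
      intro s
      simp only [hF]
      rw [mul_left_comm, ← Real.exp_add, Real.rpow_two]
      ring_nf
    simp only [h2]
    rw [integral_const_mul, h1]
    rw [show -(b - 1 + 1) / 2 = 1 - b / 2 - 1 by ring, show (b - 1 + 1) / 2 = b / 2 by ring]
    ring
  have hG : 0 < Real.Gamma (b / 2) := Real.Gamma_pos_of_pos (by linarith)
  have h := integral_Ioi_swap_of_nonneg hFm
    (fun s hs v hv => mul_nonneg (Real.rpow_nonneg hs.le _) (Real.exp_nonneg _))
    -- A nonzero Bochner integral can only come from an integrable function.
    (fun s hs => not_imp_comm.1 integral_undef (by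
      rw [e1 s hs]; have := Real.rpow_pos_of_pos hs (b - 1); positivity))
    (fun v hv => not_imp_comm.1 integral_undef (by
      rw [e2 v hv]; have := Real.rpow_pos_of_pos hv (1 - b / 2 - 1); positivity))
  rw [setIntegral_congr_fun measurableSet_Ioi fun s hs => e1 s hs,
    setIntegral_congr_fun measurableSet_Ioi fun v hv => e2 v hv, integral_const_mul,
    Real.integral_rpow_mul_exp_neg_mul_Ioi (by linarith) one_pos] at h
  rw [h]
  simp; ring

lemma integral_one_sub_cos_mul_exp {s : ℝ} (hs : 0 < s) :
    IntegrableOn (fun x => (1 - Real.cos x) * Real.exp (-(s * x))) (Set.Ioi 0) ∧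
    ∫ x in Set.Ioi 0, (1 - Real.cos x) * Real.exp (-(s * x)) = 1 / (s * (1 + s ^ 2)) := by
  have ha : (-(s : ℂ) + Complex.I).re < 0 := by simpa using hs
  have i1 := integrableOn_exp_mul_complex_Ioi ha 0
  have v1 := integral_exp_mul_complex_Ioi ha 0
  have hre : ∀ x : ℝ, (Complex.exp ((-(s : ℂ) + Complex.I) * x)).re =
      Real.exp (-(s * x)) * Real.cos x := by
    intro x
    rw [Complex.exp_re]; simp
  have i2 : IntegrableOn (fun x => Real.exp (-(s * x)) * Real.cos x) (Set.Ioi 0) := by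
    have := i1.re
    simpa only [RCLike.re_to_complex, hre, IntegrableOn] using this
  have v2 : ∫ x in Set.Ioi 0, Real.exp (-(s * x)) * Real.cos x = s / (1 + s ^ 2) := by
    have := integral_re i1
    simp only [RCLike.re_to_complex, hre] at this
    rw [this, v1]
    simp [Complex.div_re, Complex.normSq_apply]
    ring_nf
  have i3 : IntegrableOn (fun x => Real.exp (-(s * x))) (Set.Ioi 0) := by
    have := integrableOn_exp_mul_Ioi (a := -s) (by linarith) 0
    simpa only [neg_mul] using this
  have v3 : ∫ x in Set.Ioi 0, Real.exp (-(s * x)) = 1 / s := by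
    have := integral_exp_mul_Ioi (a := -s) (by linarith) 0
    simp only [neg_mul] at this
    rw [this]; simp
  have h : ∀ x, (1 - Real.cos x) * Real.exp (-(s * x)) =
      Real.exp (-(s * x)) - Real.exp (-(s * x)) * Real.cos x := fun x => by ring
  simp only [h]
  refine ⟨i3.sub i2, ?_⟩
  rw [integral_sub i3 i2, v2, v3]
  field_simp
  ring

/-- `∫₀^∞ (1 - cos x) x^{-β-1} dx = Γ(β/2) Γ(1 - β/2) / (2 Γ(β+1))`. -/
lemma integral_one_sub_cos_mul_rpow {b : ℝ} (hb : 0 < b) (hb2 : b < 2) :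
    ∫ x in Set.Ioi 0, (1 - Real.cos x) * x ^ (-b - 1) =
      Real.Gamma (b / 2) * Real.Gamma (1 - b / 2) / 2 / Real.Gamma (b + 1) := by
  have hG : 0 < Real.Gamma (b + 1) := Real.Gamma_pos_of_pos (by linarith)
  -- The power `x^{-b-1}` is `Γ(b+1)⁻¹ ∫ s^b e^{-xs} ds`; exchanging the integrals reduces to the
  -- Laplace transform of `1 - cos`.
  set F : ℝ → ℝ → ℝ := fun x s => (1 - Real.cos x) * (s ^ (b + 1 - 1) * Real.exp (-(x * s))) with hF
  have hFm : Measurable (Function.uncurry F) := by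
    simp only [hF]; unfold Function.uncurry; fun_prop
  have e0 : ∀ x, 0 < x → ∫ s in Set.Ioi 0, s ^ (b + 1 - 1) * Real.exp (-(x * s)) =
      x ^ (-b - 1) * Real.Gamma (b + 1) := by
    intro x hx
    rw [Real.integral_rpow_mul_exp_neg_mul_Ioi (by linarith) hx, one_div,
      Real.inv_rpow hx.le, ← Real.rpow_neg hx.le, neg_add']
  have e1 : ∀ x, 0 < x → ∫ s in Set.Ioi 0, F x s =
      Real.Gamma (b + 1) * ((1 - Real.cos x) * x ^ (-b - 1)) := by
    intro x hx
    simp only [hF]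
    rw [integral_const_mul, e0 x hx]
    ring
  have hF2 : ∀ s x, F x s = s ^ b * ((1 - Real.cos x) * Real.exp (-(s * x))) := by
    intro s x
    simp only [hF]
    rw [add_sub_cancel_right, mul_comm x s]
    ring
  have e2 : ∀ s, 0 < s → ∫ x in Set.Ioi 0, F x s = s ^ (b - 1) / (1 + s ^ 2) := by
    intro s hs
    simp only [hF2]
    rw [integral_const_mul, (integral_one_sub_cos_mul_exp hs).2, Real.rpow_sub_one hs.ne']
    field_simp
  have h := integral_Ioi_swap_of_nonneg hFm
    (fun x hx s hs => mul_nonneg (sub_nonneg.2 (Real.cos_le_one _))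
      (mul_nonneg (Real.rpow_nonneg hs.le _) (Real.exp_nonneg _)))
    (fun x hx => by
      simp only [hF]
      refine Integrable.const_mul (not_imp_comm.1 integral_undef ?_) _
      rw [e0 x hx]; have := Real.rpow_pos_of_pos hx (-b - 1); positivity)
    (fun s hs => by
      simp only [hF2]
      exact (integral_one_sub_cos_mul_exp hs).1.const_mul _)
  rw [setIntegral_congr_fun measurableSet_Ioi fun s hs => e1 s hs,
    setIntegral_congr_fun measurableSet_Ioi fun v hv => e2 v hv, integral_const_mul,
    integral_rpow_div_one_add_sq hb hb2] at h
  rw [← h]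
  field_simp

/-! ### Signed powers and the constant `c(β)`. -/

lemma measurable_sign : Measurable Real.sign := by
  unfold Real.sign
  exact Measurable.ite measurableSet_Iio measurable_const
    (Measurable.ite measurableSet_Ioi measurable_const measurable_const)

lemma measurable_signedPow (b : ℝ) : Measurable fun y => signedPow y b :=
  measurable_sign.mul (by fun_prop)

lemma signedPow_neg (y b : ℝ) : signedPow (-y) b = -signedPow y b := by
  simp [signedPow, Real.sign_neg]

lemma abs_signedPow {y : ℝ} (hy : y ≠ 0) (b : ℝ) : |signedPow y b| = |y| ^ b := by
  have h : |Real.sign y| = 1 := by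
    rcases lt_or_gt_of_ne hy with h | h
    · simp [Real.sign_of_neg h]
    · simp [Real.sign_of_pos h]
  rw [signedPow, abs_mul, h, one_mul, abs_of_nonneg (Real.rpow_nonneg (abs_nonneg _) _)]

lemma abs_signedPow_le (y b : ℝ) : |signedPow y b| ≤ |y| ^ b := by
  by_cases hy : y = 0
  · simpa [hy, signedPow] using Real.rpow_nonneg le_rfl b
  · exact (abs_signedPow hy b).le

/-- The scale integral of the jump measure of a symmetric `β`-stable law. -/
noncomputable def stableIntegral (β : ℝ) : ℝ := ∫ y, (1 - Real.cos (signedPow y (-1 / β)))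

lemma cos_mul_signedPow {y : ℝ} (hy : y ≠ 0) (c b : ℝ) :
    Real.cos (c * signedPow y b) = Real.cos (|c| * |y| ^ b) := by
  rw [← Real.cos_abs, abs_mul, abs_signedPow hy]

/-- Substitute `|y| = x^{-β}` and use Euler's reflection formula. Unlike the expression with `Γ(1 -
β) cos(πβ/2)`, this form remains valid at `β = 1`. -/
lemma stableIntegral_eq {β : ℝ} (hβ : β ∈ Set.Ioo (0 : ℝ) 2) :
    stableIntegral β = Real.pi / (Real.Gamma β * Real.sin (Real.pi * β / 2)) := by
  obtain ⟨h0, h2⟩ := hβ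
  have h1 : stableIntegral β = ∫ y, (1 - Real.cos (|y| ^ (-1 / β))) := by
    refine integral_congr_ae ?_
    filter_upwards [Measure.ae_ne volume (0 : ℝ)] with y hy
    have := cos_mul_signedPow hy 1 (-1 / β)
    simp only [one_mul, abs_one] at this
    rw [this]
  have h3 := integral_comp_rpow_Ioi (fun y => 1 - Real.cos (y ^ (-1 / β))) (p := -β) (by linarith)
  have h4 : ∀ x ∈ Set.Ioi (0 : ℝ), (|-β| * x ^ (-β - 1)) • (1 - Real.cos ((x ^ (-β)) ^ (-1 / β))) =
      β * ((1 - Real.cos x) * x ^ (-β - 1)) := by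
    intro x hx
    rw [← Real.rpow_mul (le_of_lt hx), show -β * (-1 / β) = 1 by field_simp, Real.rpow_one, abs_neg,
      abs_of_pos h0, smul_eq_mul]
    ring
  rw [setIntegral_congr_fun measurableSet_Ioi h4, integral_const_mul,
    integral_one_sub_cos_mul_rpow h0 h2] at h3
  rw [h1, integral_comp_abs (f := fun y => 1 - Real.cos (y ^ (-1 / β))), ← h3,
    Real.Gamma_add_one h0.ne', Real.Gamma_mul_Gamma_one_sub]
  have hG : 0 < Real.Gamma β := Real.Gamma_pos_of_pos h0
  have hs : 0 < Real.sin (Real.pi * β / 2) := Real.sin_pos_of_pos_of_lt_pi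
    (by have := Real.pi_pos; positivity) (by nlinarith [Real.pi_pos])
  rw [show Real.pi * (β / 2) = Real.pi * β / 2 by ring]
  field_simp

lemma stableIntegral_pos {β : ℝ} (hβ : β ∈ Set.Ioo (0 : ℝ) 2) : 0 < stableIntegral β := by
  rw [stableIntegral_eq hβ]
  have hG : 0 < Real.Gamma β := Real.Gamma_pos_of_pos hβ.1
  have hs : 0 < Real.sin (Real.pi * β / 2) := Real.sin_pos_of_pos_of_lt_pi
    (by have := Real.pi_pos; have := hβ.1; positivity) (by nlinarith [Real.pi_pos, hβ.2])
  have := Real.pi_pos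
  positivity

lemma stableIntegral_eq_gamma_mul_cos {β : ℝ} (hβ : β ∈ Set.Ioo (0 : ℝ) 2) (h1 : β ≠ 1) :
    stableIntegral β = 2 * Real.Gamma (1 - β) * Real.cos (Real.pi * β / 2) := by
  rw [stableIntegral_eq hβ]
  have hG : 0 < Real.Gamma β := Real.Gamma_pos_of_pos hβ.1
  have hs : 0 < Real.sin (Real.pi * β / 2) := Real.sin_pos_of_pos_of_lt_pi
    (by have := Real.pi_pos; have := hβ.1; positivity) (by nlinarith [Real.pi_pos, hβ.2])
  have hc : Real.cos (Real.pi * β / 2) ≠ 0 := by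
    rcases lt_or_gt_of_ne h1 with h | h
    · exact (Real.cos_pos_of_mem_Ioo ⟨by nlinarith [Real.pi_pos, hβ.1],
        by nlinarith [Real.pi_pos]⟩).ne'
    · exact (Real.cos_neg_of_pi_div_two_lt_of_lt (by nlinarith [Real.pi_pos])
        (by nlinarith [Real.pi_pos, hβ.2])).ne
  have h2 := Real.Gamma_mul_Gamma_one_sub β
  have h3 : Real.sin (Real.pi * β) =
      2 * Real.sin (Real.pi * β / 2) * Real.cos (Real.pi * β / 2) := by
    rw [← Real.sin_two_mul]; ring_nf
  rw [h3] at h2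
  have h4 : Real.Gamma (1 - β) = Real.pi /
      (2 * Real.sin (Real.pi * β / 2) * Real.cos (Real.pi * β / 2)) / Real.Gamma β := by
    rw [← h2]; field_simp
  rw [h4]
  field_simp

lemma stableConst_eq {β : ℝ} (hβ : β ∈ Set.Ioo (0 : ℝ) 2) (h1 : β ≠ 1) :
    stableConst β = stableIntegral β ^ (-1 / β) := by
  rw [stableConst, if_neg h1, stableIntegral_eq_gamma_mul_cos hβ h1]

lemma stableConst_pos {β : ℝ} (hβ : β ∈ Set.Ioo (0 : ℝ) 2) (h1 : β ≠ 1) : 0 < stableConst β := by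
  rw [stableConst_eq hβ h1]
  exact Real.rpow_pos_of_pos (stableIntegral_pos hβ) _

lemma stableIntegral_mul_stableConst_rpow {β : ℝ} (hβ : β ∈ Set.Ioo (0 : ℝ) 2) (h1 : β ≠ 1) :
    stableIntegral β * stableConst β ^ β = 1 := by
  have h := stableIntegral_pos hβ
  rw [stableConst_eq hβ h1, ← Real.rpow_mul h.le,
    show -1 / β * β = -1 by have := hβ.1; field_simp, Real.rpow_neg_one, mul_inv_cancel₀ h.ne']

lemma differentiableAt_stableConst {β : ℝ} (hβ : β ∈ Set.Ioo (0 : ℝ) 2) (h1 : β ≠ 1) :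
    DifferentiableAt ℝ stableConst β := by
  have h2 : stableConst =ᶠ[𝓝 β] fun β =>
      (2 * Real.Gamma (1 - β) * Real.cos (Real.pi * β / 2)) ^ (-1 / β) := by
    filter_upwards [isOpen_ne.mem_nhds h1] with b hb
    rw [stableConst, if_neg hb]
  refine DifferentiableAt.congr_of_eventuallyEq ?_ h2
  have hG : DifferentiableAt ℝ Real.Gamma (1 - β) := by
    -- As `1 - β > -1`, the only pole within reach is `0`, excluded by `β ≠ 1`.
    refine Real.differentiableAt_Gamma fun m hm => ?_
    rcases m with _ | m
    · exact h1 (by simp at hm; linarith)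
    · push_cast at hm
      have : (0 : ℝ) ≤ m := m.cast_nonneg
      linarith [hβ.2]
  refine DifferentiableAt.rpow ?_ ?_ ?_
  · refine DifferentiableAt.mul (DifferentiableAt.const_mul ?_ _) (by fun_prop)
    exact DifferentiableAt.comp (g := Real.Gamma) (f := fun b => 1 - b) β hG (by fun_prop)
  · exact (differentiableAt_const _).div differentiableAt_id hβ.1.ne'
  · rw [← stableIntegral_eq_gamma_mul_cos hβ h1]
    exact (stableIntegral_pos hβ).ne'

/-- The dilation `y ↦ |c|^{-β} y` absorbs the factor `|c|`, and evenness of `φ` discards signs. The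
test function is left general to serve both `1 - cos x` and `min 1 x²`. -/
lemma integral_comp_mul_signedPow {β : ℝ} (hβ : 0 < β) {φ : ℝ → ℝ} (hφ : ∀ x, φ (-x) = φ x)
    (hφ0 : φ 0 = 0) (c : ℝ) :
    ∫ y, φ (c * signedPow y (-1 / β)) = (∫ y, φ (signedPow y (-1 / β))) * |c| ^ β := by
  by_cases hc : c = 0
  · simp [hc, Real.zero_rpow hβ.ne', hφ0]
  have hc' : 0 < |c| := abs_pos.2 hc
  have ha : 0 < |c| ^ (-β) := Real.rpow_pos_of_pos hc' _
  have hφa : ∀ x, φ |x| = φ x := fun x => by rcases abs_choice x with h | h <;> simp [h, hφ]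
  have h1 := Measure.integral_comp_mul_left (fun y => φ (signedPow y (-1 / β))) (|c| ^ (-β))
  have h2 : ∫ y, φ (c * signedPow y (-1 / β)) =
      ∫ y, φ (signedPow (|c| ^ (-β) * y) (-1 / β)) := by
    refine integral_congr_ae ?_
    filter_upwards [Measure.ae_ne volume (0 : ℝ)] with y hy
    rw [← hφa, ← hφa (signedPow _ _), abs_signedPow (mul_ne_zero ha.ne' hy), abs_mul,
      abs_signedPow hy, abs_mul, abs_of_pos ha,
      Real.mul_rpow ha.le (abs_nonneg _), ← Real.rpow_mul hc'.le,
      show -β * (-1 / β) = 1 by field_simp, Real.rpow_one]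
  rw [h2, h1, abs_of_pos (inv_pos.2 ha), Real.rpow_neg hc'.le, inv_inv, smul_eq_mul, mul_comm]

lemma integral_comp_spatial_mul_signedPow {β : ℝ} (hβ : 0 < β) {φ : ℝ → ℝ}
    (hφ : ∀ x, φ (-x) = φ x) (hφ0 : φ 0 = 0) {k : ℝ → ℝ}
    (hi : Integrable fun p : ℝ × ℝ => φ (k p.1 * signedPow p.2 (-1 / β))) :
    ∫ p : ℝ × ℝ, φ (k p.1 * signedPow p.2 (-1 / β)) =
      (∫ y, φ (signedPow y (-1 / β))) * ∫ x, |k x| ^ β := by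
  rw [Measure.volume_eq_prod] at hi ⊢
  rw [integral_prod _ hi]
  simp only [integral_comp_mul_signedPow hβ hφ hφ0]
  rw [integral_const_mul]

/-! ### Integrable domination of kernels. -/

/-- The integrable function that dominates the kernels: supported in `|x| ≤ K`, of order
`|y|^{-p}` for large `y`. -/
noncomputable def decay (K p : ℝ) (q : ℝ × ℝ) : ℝ :=
  (Set.Icc (-K) K).indicator 1 q.1 * ((1 + |q.2|) / 2) ^ (-p)

lemma integrable_decay (K : ℝ) {p : ℝ} (hp : 1 < p) : Integrable (decay K p) := by
  rw [Measure.volume_eq_prod]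
  refine Integrable.mul_prod (f := (Set.Icc (-K) K).indicator 1)
    (g := fun y : ℝ => ((1 + |y|) / 2) ^ (-p)) ?_ ?_
  · exact (integrable_indicator_iff measurableSet_Icc).2 (integrableOn_const (by simp))
  · have h := (integrable_one_add_norm (E := ℝ) (μ := volume) (r := p) (by simpa using hp)).div_const
      ((2 : ℝ) ^ (-p))
    refine h.congr (ae_of_all _ fun y => ?_)
    simp only [Real.norm_eq_abs]
    rw [Real.div_rpow (by positivity) (by norm_num)]

/-- The average `(1 + |y|) / 2` lies between `1` and `|y|`, so one power bounds both ranges of `y`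
without a singularity at `0`. -/
lemma le_mul_rpow_of_decay {m C p y : ℝ} (hp : 0 < p) (hC : 0 ≤ C) (h1 : m ≤ 1)
    (h2 : 1 ≤ |y| → m ≤ C * |y| ^ (-p)) : m ≤ (1 + C) * ((1 + |y|) / 2) ^ (-p) := by
  have h3 : 0 < (1 + |y|) / 2 := by positivity
  have h4 : 0 < ((1 + |y|) / 2) ^ (-p) := Real.rpow_pos_of_pos h3 _
  rcases le_total 1 |y| with h | h
  · have h5 : |y| ^ (-p) ≤ ((1 + |y|) / 2) ^ (-p) :=
      Real.rpow_le_rpow_of_nonpos h3 (by linarith) (by linarith)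
    calc m ≤ C * |y| ^ (-p) := h2 h
      _ ≤ C * ((1 + |y|) / 2) ^ (-p) := by gcongr
      _ ≤ _ := by linarith
  · have h5 : 1 ≤ ((1 + |y|) / 2) ^ (-p) :=
      Real.one_le_rpow_of_pos_of_le_one_of_nonpos h3 (by linarith) (by linarith)
    nlinarith

section

variable {g : ℝ × ℝ → ℝ} {K C q : ℝ}

lemma min_one_sq_le_decay (hq : 0 < q) (hK : ∀ x y, K < |x| → g (x, y) = 0)
    (hC : ∀ x y, 1 ≤ |y| → |g (x, y)| ≤ C * |y| ^ (-q)) (p : ℝ × ℝ) :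
    min 1 (g p ^ 2) ≤ (1 + C ^ 2) * decay K (2 * q) p := by
  obtain ⟨x, y⟩ := p
  by_cases hx : K < |x|
  · rw [hK x y hx, decay, Set.indicator_of_notMem]
    · simp
    · exact fun h => absurd (abs_le.2 h) (not_le.2 hx)
  · rw [decay, Set.indicator_of_mem (Set.mem_Icc.2 (abs_le.1 (not_lt.1 hx))), Pi.one_apply, one_mul]
    refine le_mul_rpow_of_decay (by linarith) (sq_nonneg _) (min_le_left _ _) fun hy => ?_
    refine (min_le_right _ _).trans ?_
    have h1 := hC x y hy
    calc g (x, y) ^ 2 = |g (x, y)| ^ 2 := (sq_abs _).symm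
      _ ≤ (C * |y| ^ (-q)) ^ 2 := by gcongr
      _ = C ^ 2 * |y| ^ (-(2 * q)) := by
        rw [mul_pow, ← Real.rpow_mul_natCast (abs_nonneg y)]
        congr 2
        push_cast; ring

lemma isSymmetricKernel_of_decay (hm : Measurable g) (ho : ∀ x y, g (x, -y) = -g (x, y))
    (hq : 1 / 2 < q) (hK : ∀ x y, K < |x| → g (x, y) = 0)
    (hC : ∀ x y, 1 ≤ |y| → |g (x, y)| ≤ C * |y| ^ (-q)) : IsSymmetricKernel g :=
  .of_le hm ho ((integrable_decay K (p := 2 * q) (by linarith)).const_mul (1 + C ^ 2))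
    (ae_of_all _ (min_one_sq_le_decay (by linarith) hK hC))

lemma integrable_min_one_abs_of_decay (hm : Measurable g)
    (hq : 1 < q) (hK : ∀ x y, K < |x| → g (x, y) = 0)
    (hC : ∀ x y, 1 ≤ |y| → |g (x, y)| ≤ C * |y| ^ (-q)) :
    Integrable fun p => min 1 |g p| := by
  have hC0 : 0 ≤ C := by
    have := (abs_nonneg _).trans (hC 0 1 (by simp))
    simpa using this
  refine ((integrable_decay K hq).const_mul (1 + C)).mono'
    (measurable_const.min hm.abs).aestronglyMeasurable (ae_of_all _ fun p => ?_)
  rw [Real.norm_of_nonneg (le_min zero_le_one (abs_nonneg _))]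
  obtain ⟨x, y⟩ := p
  by_cases hx : K < |x|
  · rw [hK x y hx, decay, Set.indicator_of_notMem]
    · simp
    · exact fun h => absurd (abs_le.2 h) (not_le.2 hx)
  · rw [decay, Set.indicator_of_mem (Set.mem_Icc.2 (abs_le.1 (not_lt.1 hx))), Pi.one_apply, one_mul]
    exact le_mul_rpow_of_decay (by linarith) hC0 (min_le_left _ _) fun hy =>
      (min_le_right _ _).trans (hC x y hy)

end

/-- Dominated convergence: truncation controls `|y| < 1`, and `2q > 1` makes the tail integrable. -/
lemma tendsto_integral_min_one_sq_of_decay {G : ℝ → ℝ × ℝ → ℝ} {l : Filter ℝ}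
    [l.IsCountablyGenerated] {K C q : ℝ} (hq : 1 / 2 < q)
    (hm : ∀ r, Measurable (G r)) (hK : ∀ᶠ r in l, ∀ x y, K < |x| → G r (x, y) = 0)
    (hC : ∀ᶠ r in l, ∀ x y, 1 ≤ |y| → |G r (x, y)| ≤ C * |y| ^ (-q))
    (hlim : ∀ᵐ p, Tendsto (fun r => G r p) l (𝓝 0)) :
    Tendsto (fun r => ∫ p, min 1 (G r p ^ 2)) l (𝓝 0) := by
  have h := tendsto_integral_filter_of_dominated_convergence (μ := volume) (l := l)
    (F := fun r p => min 1 (G r p ^ 2)) (f := fun _ => 0)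
    (fun p => (1 + C ^ 2) * decay K (2 * q) p)
    (Eventually.of_forall fun r => (measurable_const.min ((hm r).pow_const 2)).aestronglyMeasurable)
    (by
      filter_upwards [hK, hC] with r h1 h2
      refine ae_of_all _ fun p => ?_
      rw [Real.norm_of_nonneg (min_one_sq_nonneg _)]
      exact min_one_sq_le_decay (by linarith) h1 h2 p)
    ((integrable_decay K (by linarith)).const_mul _)
    (by
      filter_upwards [hlim] with p hp
      have h3 := (tendsto_const_nhds (x := (1 : ℝ))).min (hp.pow 2)
      simpa using h3)
  simpa using h

/-! ### Oriented indicators, their increments and the resulting kernels. -/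

lemma orientedIndicator_of_pos {x : ℝ} (hx : 0 < x) (t : ℝ) :
    orientedIndicator t x = if x ≤ t then 1 else 0 := by
  rcases le_or_gt 0 t with ht | ht
  · simp [orientedIndicator, ht, Set.indicator_apply, hx.le]
  · simp [orientedIndicator, not_le.2 ht, not_le.2 hx,
      not_le.2 (ht.trans hx)]

lemma orientedIndicator_of_neg {x : ℝ} (hx : x < 0) (t : ℝ) :
    orientedIndicator t x = if t ≤ x then -1 else 0 := by
  rcases le_or_gt 0 t with ht | ht
  · simp [orientedIndicator, ht, not_le.2 hx, not_le.2 (hx.trans_le ht)]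
  · by_cases h : t ≤ x <;>
    simp [orientedIndicator, not_le.2 ht, hx.le, h]

lemma measurable_orientedIndicator (t : ℝ) : Measurable (orientedIndicator t) := by
  unfold orientedIndicator
  split_ifs
  · exact (measurable_const (a := (1 : ℝ))).indicator measurableSet_Icc
  · exact ((measurable_const (a := (1 : ℝ))).indicator measurableSet_Icc).neg

lemma abs_orientedIndicator_le (t x : ℝ) : |orientedIndicator t x| ≤ 1 := by
  unfold orientedIndicator
  split_ifs <;> simp only [Set.indicator_apply] <;> split_ifs <;> simp

lemma orientedIndicator_eq_zero {t x : ℝ} (h : |t| < |x|) : orientedIndicator t x = 0 := by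
  rcases lt_trichotomy x 0 with hx | hx | hx
  · rw [orientedIndicator_of_neg hx, if_neg]
    rw [abs_of_neg hx] at h
    intro h2
    linarith [neg_abs_le t]
  · rw [hx, abs_zero] at h
    exact absurd h (not_lt.2 (abs_nonneg _))
  · rw [orientedIndicator_of_pos hx, if_neg]
    rw [abs_of_pos hx] at h
    intro h2
    linarith [le_abs_self t]

/-- The sign convention makes the increment the signed indicator of the interval between `a` and
`b`; at least one of the two intervals is empty. The excluded points form a null set. -/
lemma orientedIndicator_sub {a b x : ℝ} (h0 : x ≠ 0) (ha : x ≠ a) (hb : x ≠ b) :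
    orientedIndicator b x - orientedIndicator a x =
      (Set.Ioo a b).indicator 1 x - (Set.Ioo b a).indicator 1 x := by
  simp only [Set.indicator_apply, Set.mem_Ioo, Pi.one_apply]
  rcases lt_or_gt_of_ne h0 with hx | hx
  · simp only [orientedIndicator_of_neg hx]
    rcases lt_or_gt_of_ne ha with h1 | h1 <;> rcases lt_or_gt_of_ne hb with h2 | h2 <;>
      simp [h1, h2, not_lt.2 h1.le, not_lt.2 h2.le, h1.le, h2.le, not_le.2 h1, not_le.2 h2]
  · simp only [orientedIndicator_of_pos hx]
    rcases lt_or_gt_of_ne ha with h1 | h1 <;> rcases lt_or_gt_of_ne hb with h2 | h2 <;>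
      simp [h1, h2, not_lt.2 h1.le, not_lt.2 h2.le, h1.le, h2.le, not_le.2 h1, not_le.2 h2]

lemma orientedIndicator_zero {x : ℝ} (h0 : x ≠ 0) : orientedIndicator 0 x = 0 :=
  orientedIndicator_eq_zero (by simpa using h0)

lemma ae_orientedIndicator_sub_comp (u t : ℝ) {r : ℝ} (hr : 0 < r) :
    ∀ᵐ x, orientedIndicator (u + r * t) (u + r * x) - orientedIndicator u (u + r * x) =
      orientedIndicator t x := by
  filter_upwards [Measure.ae_ne volume (0 : ℝ), Measure.ae_ne volume t,
    Measure.ae_ne volume (-u / r)] with x h0 h1 h2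
  have e1 : u + r * x ≠ 0 := fun h => h2 (by field_simp; linarith)
  have e2 : u + r * x ≠ u := fun h => h0 (by
    have : r * x = 0 := by linarith
    simpa [hr.ne'] using this)
  have e3 : u + r * x ≠ u + r * t := fun h => h1 (mul_left_cancel₀ hr.ne' (by linarith))
  rw [orientedIndicator_sub e1 e2 e3]
  have h3 := orientedIndicator_sub h0 h0 h1
  rw [orientedIndicator_zero h0, sub_zero] at h3
  rw [h3]
  have a1 : u < u + r * x ↔ 0 < x := by
    rw [lt_add_iff_pos_right, mul_pos_iff_of_pos_left hr]
  have a2 : u + r * x < u ↔ x < 0 := by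
    rw [add_lt_iff_neg_left]
    exact ⟨fun h => by by_contra h'; nlinarith, fun h => by nlinarith⟩
  have a3 : u + r * x < u + r * t ↔ x < t := by
    rw [add_lt_add_iff_left, mul_lt_mul_iff_right₀ hr]
  have a4 : u + r * t < u + r * x ↔ t < x := by
    rw [add_lt_add_iff_left, mul_lt_mul_iff_right₀ hr]
  simp only [Set.indicator_apply, Set.mem_Ioo, a1, a2, a3, a4, Pi.one_apply]

lemma eventually_orientedIndicator_eq {u x : ℝ} (h0 : x ≠ 0) (hu : x ≠ u) :
    ∀ᶠ v in 𝓝 u, orientedIndicator v x = orientedIndicator u x := by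
  have h1 : ∀ᶠ v in 𝓝 u, (x ≤ v ↔ x ≤ u) ∧ (v ≤ x ↔ u ≤ x) := by
    rcases lt_or_gt_of_ne hu with h | h
    · filter_upwards [lt_mem_nhds h] with v hv
      exact ⟨by simp [hv.le, h.le], by simp [not_le.2 hv, not_le.2 h]⟩
    · filter_upwards [gt_mem_nhds h] with v hv
      exact ⟨by simp [not_le.2 hv, not_le.2 h], by simp [hv.le, h.le]⟩
  filter_upwards [h1] with v hv
  rcases lt_or_gt_of_ne h0 with hx | hx
  · simp only [orientedIndicator_of_neg hx, hv.2]
  · simp only [orientedIndicator_of_pos hx, hv.1]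

lemma integral_comp_affine (f : ℝ → ℝ) (u : ℝ) {r : ℝ} (hr : 0 < r) :
    ∫ x, f x = r * ∫ x, f (u + r * x) := by
  rw [Measure.integral_comp_mul_left (fun x => f (u + x)) r, abs_of_pos (inv_pos.2 hr),
    smul_eq_mul, ← mul_assoc, mul_inv_cancel₀ hr.ne', one_mul]
  exact (integral_add_left_eq_self f u).symm

/-- The decay exponent `1/β` exceeds `1/2` precisely because `β < 2`. -/
lemma isSymmetricKernel_spatial {β : ℝ} (hβ : β ∈ Set.Ioo (0 : ℝ) 2) {k : ℝ → ℝ}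
    (hk : Measurable k) {K C : ℝ} (hC : ∀ x, |k x| ≤ C) (hK : ∀ x, K < |x| → k x = 0) :
    IsSymmetricKernel fun p => k p.1 * signedPow p.2 (-1 / β) := by
  have hC0 : 0 ≤ C := (abs_nonneg _).trans (hC 0)
  refine isSymmetricKernel_of_decay (K := K) (C := C) (q := 1 / β)
    ((hk.comp measurable_fst).mul ((measurable_signedPow _).comp measurable_snd))
    (fun x y => by simp [signedPow_neg]) (one_div_lt_one_div_of_lt hβ.1 hβ.2)
    (fun x y hx => by simp [hK x hx]) fun x y _ => ?_
  rw [abs_mul, ← neg_div]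
  exact mul_le_mul (hC x) (abs_signedPow_le _ _) (abs_nonneg _) hC0

lemma isSymmetricKernel_levyKernel {β : ℝ} (hβ : β ∈ Set.Ioo (0 : ℝ) 2) (t : ℝ) :
    IsSymmetricKernel (levyKernel β t) :=
  isSymmetricKernel_spatial hβ (measurable_orientedIndicator t) (abs_orientedIndicator_le t)
    fun _ => orientedIndicator_eq_zero

lemma sumConvergesAbsolutely_levyKernel {Ω : Type*} [MeasurableSpace Ω] {P : Measure Ω}
    [IsProbabilityMeasure P] {S : Ω → Set (ℝ × ℝ)} {E : ℕ → Set ℝ}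
    (hS : IsPoissonProcess S volume P) (hE : IsExhaustion E) {β : ℝ} (h0 : 0 < β) (h1 : β < 1)
    (t : ℝ) : SumConvergesAbsolutely S E (levyKernel β t) P := by
  have hm := (isSymmetricKernel_levyKernel (β := β) ⟨h0, by linarith⟩ t).measurable
  refine sumConvergesAbsolutely_of_integrable hS hE hm
    (integrable_min_one_abs_of_decay (K := |t|) (C := 1) (q := 1 / β) hm
      (by rwa [lt_div_iff₀ h0, one_mul])
      (fun x y hx => by simp [levyKernel, orientedIndicator_eq_zero hx]) fun x y _ => ?_)
  rw [levyKernel, abs_mul, ← neg_div]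
  exact mul_le_mul (abs_orientedIndicator_le _ _) (abs_signedPow_le _ _) (abs_nonneg _) zero_le_one

lemma IsSymmetricKernel.integral_one_sub_cos_spatial {β : ℝ} (hβ : 0 < β) {k : ℝ → ℝ}
    (hk : IsSymmetricKernel fun p => k p.1 * signedPow p.2 (-1 / β)) :
    ∫ p : ℝ × ℝ, (1 - Real.cos (k p.1 * signedPow p.2 (-1 / β))) =
      stableIntegral β * ∫ x, |k x| ^ β :=
  integral_comp_spatial_mul_signedPow hβ (φ := fun x => 1 - Real.cos x) (by simp) (by simp)
    hk.integrable_one_sub_cos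

/-! ### Variation of the kernel in the amplitude and the exponent. -/

/-- Changing the exponent costs a factor `log y`, which `log y ≤ y^ε / ε` absorbs by giving up `ε`
of decay. -/
lemma abs_rpow_neg_sub_le {y p p' q ε : ℝ} (hy : 1 ≤ y) (hε : 0 < ε) (hp : q + ε ≤ p)
    (hp' : q + ε ≤ p') : |y ^ (-p) - y ^ (-p')| ≤ |p - p'| / ε * y ^ (-q) := by
  wlog h : p ≤ p' generalizing p p'
  · rw [abs_sub_comm, abs_sub_comm p]
    exact this hp' hp (le_of_not_ge h)
  have hy0 : 0 < y := by linarith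
  have hl : 0 ≤ Real.log y := Real.log_nonneg hy
  have e1 : y ^ (-p') = y ^ (-p) * Real.exp (-((p' - p) * Real.log y)) := by
    rw [Real.rpow_def_of_pos hy0, Real.rpow_def_of_pos hy0, ← Real.exp_add]
    ring_nf
  have e2 : y ^ (-p) - y ^ (-p') = y ^ (-p) * (1 - Real.exp (-((p' - p) * Real.log y))) := by
    rw [e1]; ring
  have e3 : Real.exp (-((p' - p) * Real.log y)) ≤ 1 := by
    rw [Real.exp_le_one_iff]; nlinarith
  have e4 := Real.add_one_le_exp (-((p' - p) * Real.log y))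
  have e5 : y ^ (-p) ≤ y ^ (-(q + ε)) := Real.rpow_le_rpow_of_exponent_le hy (by linarith)
  have e6 := Real.log_le_rpow_div hy0.le hε
  have e7 : 0 < y ^ (-p) := Real.rpow_pos_of_pos hy0 _
  rw [e2, abs_of_nonneg (mul_nonneg e7.le (by linarith)), abs_sub_comm,
    abs_of_nonneg (sub_nonneg.2 h)]
  calc y ^ (-p) * (1 - Real.exp (-((p' - p) * Real.log y)))
      ≤ y ^ (-(q + ε)) * ((p' - p) * (y ^ ε / ε)) := by
        refine mul_le_mul e5 ?_ (by linarith) (Real.rpow_nonneg hy0.le _)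
        have := mul_le_mul_of_nonneg_left e6 (sub_nonneg.2 h)
        linarith
    _ = (p' - p) / ε * (y ^ (-(q + ε)) * y ^ ε) := by ring
    _ = (p' - p) / ε * y ^ (-q) := by
        rw [← Real.rpow_add hy0]; ring_nf

section

variable {A α : ℝ → ℝ} {u : ℝ}

/-- A first-order bound in `v - u`, uniform in `|y| ≥ 1`: vary `A` and the exponent separately. The
logarithm produced by the exponent is why `q` must stay strictly below `1 / α u`. -/
lemma eventually_abs_mul_signedPow_sub_le (hA : DifferentiableAt ℝ A u)
    (hα : DifferentiableAt ℝ α u) (hα0 : α u ≠ 0) {q : ℝ} (hq : q < 1 / α u) :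
    ∃ C, ∀ᶠ v in 𝓝 u, ∀ y, 1 ≤ |y| →
      |A v * signedPow y (-1 / α v) - A u * signedPow y (-1 / α u)| ≤
        C * |v - u| * |y| ^ (-q) := by
  set p : ℝ → ℝ := fun v => 1 / α v with hp
  have hpd : DifferentiableAt ℝ p u := (differentiableAt_const _).div hα hα0
  obtain ⟨c1, hc1⟩ := hA.hasDerivAt.differentiableAt.isBigO_sub.bound
  obtain ⟨c2, hc2⟩ := hpd.isBigO_sub.bound
  -- Half the gap, so that `q + ε < 1 / α v` still holds for `v` near `u`.
  set ε := (1 / α u - q) / 2 with hε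
  have hε0 : 0 < ε := by rw [hε]; linarith
  have hlt : q + ε < p u := by simp only [hp, hε]; linarith
  refine ⟨c1 + |A u| * (c2 / ε), ?_⟩
  filter_upwards [hc1, hc2, hpd.continuousAt.eventually (lt_mem_nhds hlt)] with v h1 h2 h3 y hy
  simp only [Real.norm_eq_abs] at h1 h2
  have hy0 : y ≠ 0 := by rintro rfl; simp at hy; linarith
  have hs : |Real.sign y| = 1 := by
    have := abs_signedPow hy0 0
    simpa [signedPow] using this
  have e1 : A v * signedPow y (-1 / α v) - A u * signedPow y (-1 / α u) =
      Real.sign y * ((A v - A u) * |y| ^ (-p v) + A u * (|y| ^ (-p v) - |y| ^ (-p u))) := by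
    simp only [signedPow, hp, neg_div]; ring
  rw [e1, abs_mul, hs, one_mul]
  have e2 : |y| ^ (-p v) ≤ |y| ^ (-q) := Real.rpow_le_rpow_of_exponent_le hy (by linarith)
  have e3 : 0 ≤ |y| ^ (-p v) := Real.rpow_nonneg (abs_nonneg _) _
  have e4 := abs_rpow_neg_sub_le hy hε0 h3.le hlt.le
  have e5 : 0 ≤ |y| ^ (-q) := Real.rpow_nonneg (abs_nonneg _) _
  calc |(A v - A u) * |y| ^ (-p v) + A u * (|y| ^ (-p v) - |y| ^ (-p u))|
      ≤ |A v - A u| * |y| ^ (-p v) + |A u| * |(|y| ^ (-p v) - |y| ^ (-p u))| := by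
        refine (abs_add_le _ _).trans ?_
        rw [abs_mul, abs_mul, abs_of_nonneg e3]
    _ ≤ c1 * |v - u| * |y| ^ (-q) + |A u| * (c2 * |v - u| / ε * |y| ^ (-q)) := by
        refine add_le_add (mul_le_mul h1 e2 e3 ((abs_nonneg _).trans h1)) ?_
        refine mul_le_mul_of_nonneg_left (e4.trans ?_) (abs_nonneg _)
        gcongr
    _ = _ := by ring

lemma hasDerivAt_mul_signedPow (hA : DifferentiableAt ℝ A u)
    (hα : DifferentiableAt ℝ α u) (hα0 : α u ≠ 0) {y : ℝ} (hy : y ≠ 0) :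
    HasDerivAt (fun v => A v * signedPow y (-1 / α v))
      (signedPow y (-1 / α u) * (A u * (deriv α u / α u ^ 2) * Real.log |y| + deriv A u)) u := by
  have h1 : HasDerivAt (fun v => -1 / α v) (deriv α u / α u ^ 2) u := by
    have := (hasDerivAt_const u (-1 : ℝ)).div hα.hasDerivAt hα0
    simpa [Pi.div_def] using this
  have h2 := (h1.const_rpow (abs_pos.2 hy)).const_mul (Real.sign y)
  have h3 := hA.hasDerivAt.mul h2
  unfold signedPow
  convert! h3 using 1
  ring

/-- Difference quotients of `v ↦ A(v) y^{<-1/α(v)>}` along `v = u + r t`. -/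
lemma tendsto_div_mul_signedPow_sub (hA : DifferentiableAt ℝ A u)
    (hα : DifferentiableAt ℝ α u) (hα0 : α u ≠ 0) {y : ℝ} (hy : y ≠ 0) (t : ℝ) :
    Tendsto (fun r => (A (u + r * t) * signedPow y (-1 / α (u + r * t)) -
      A u * signedPow y (-1 / α u)) / r) (𝓝[>] 0)
      (𝓝 (t * (signedPow y (-1 / α u) *
        (A u * (deriv α u / α u ^ 2) * Real.log |y| + deriv A u)))) := by
  have h1 : HasDerivAt (fun r : ℝ => u + r * t) t 0 := by
    simpa using ((hasDerivAt_id (0 : ℝ)).mul_const t).const_add u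
  have h2 : HasDerivAt (fun v => A v * signedPow y (-1 / α v))
      (signedPow y (-1 / α u) * (A u * (deriv α u / α u ^ 2) * Real.log |y| + deriv A u))
      (u + 0 * t) := by
    simpa using hasDerivAt_mul_signedPow hA hα hα0 hy
  have h3 := (h2.comp (0 : ℝ) h1).tendsto_slope_zero_right
  simp only [Function.comp_def, zero_add, zero_mul, add_zero, smul_eq_mul] at h3
  rw [mul_comm _ t] at h3
  refine h3.congr fun r => ?_
  rw [inv_mul_eq_div]

lemma tendsto_affine_nhdsGT (u t : ℝ) : Tendsto (fun r => u + r * t) (𝓝[>] 0) (𝓝 u) := by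
  have h : Tendsto (fun r => u + r * t) (𝓝 0) (𝓝 (u + 0 * t)) := by
    exact (Continuous.tendsto (by fun_prop) _)
  rw [zero_mul, add_zero] at h
  exact h.mono_left nhdsWithin_le_nhds

/-- The kernel of the part of the increment of `Y` that comes from the variation of `A` and `α`. -/
noncomputable def variationKernel (A α : ℝ → ℝ) (u v : ℝ) (p : ℝ × ℝ) : ℝ :=
  A v * levyKernel (α v) v p - A u * levyKernel (α u) v p

lemma variationKernel_eq (A α : ℝ → ℝ) (u v : ℝ) (p : ℝ × ℝ) : variationKernel A α u v p =
    orientedIndicator v p.1 *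
      (A v * signedPow p.2 (-1 / α v) - A u * signedPow p.2 (-1 / α u)) := by
  simp only [variationKernel, levyKernel]; ring

lemma isSymmetricKernel_variationKernel (hα : ∀ t, α t ∈ Set.Ioo (0 : ℝ) 2) (A : ℝ → ℝ) (u v : ℝ) :
    IsSymmetricKernel (variationKernel A α u v) :=
  ((isSymmetricKernel_levyKernel (hα v) v).const_mul _).sub
    ((isSymmetricKernel_levyKernel (hα u) v).const_mul _)

lemma eventually_abs_variationKernel_le (hA : DifferentiableAt ℝ A u)
    (hα : DifferentiableAt ℝ α u) (hα0 : α u ≠ 0) {q : ℝ} (hq : q < 1 / α u) (t : ℝ) :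
    ∃ C, ∀ᶠ r in 𝓝[>] 0, ∀ x y, 1 ≤ |y| →
      |variationKernel A α u (u + r * t) (x, y)| ≤ r * (C * |y| ^ (-q)) := by
  obtain ⟨C, hC⟩ := eventually_abs_mul_signedPow_sub_le hA hα hα0 hq
  refine ⟨C * |t|, ?_⟩
  filter_upwards [(tendsto_affine_nhdsGT u t).eventually hC, self_mem_nhdsWithin] with r h1 hr x y hy
  have hr' : 0 < r := hr
  rw [variationKernel_eq, abs_mul]
  refine (mul_le_of_le_one_left (abs_nonneg _) (abs_orientedIndicator_le _ _)).trans
    ((h1 y hy).trans (le_of_eq ?_))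
  rw [add_sub_cancel_left, abs_mul, abs_of_pos hr']
  ring

lemma eventually_variationKernel_eq_zero (u t : ℝ) :
    ∀ᶠ r in 𝓝[>] 0, ∀ x y, |u| + 1 < |x| → variationKernel A α u (u + r * t) (x, y) = 0 := by
  have h1 : ∀ᶠ v in 𝓝 u, |v| < |u| + 1 :=
    (continuous_abs.tendsto u).eventually (gt_mem_nhds (by linarith))
  filter_upwards [(tendsto_affine_nhdsGT u t).eventually h1] with r hr x y hx
  rw [variationKernel_eq, orientedIndicator_eq_zero (hr.trans hx), zero_mul]

/-- The variation is of order `r`, so dividing by `r^{1/α(u)}` leaves `r^{1 - 1/α(u)}`, which tends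
to `0`. The decay exponent is the midpoint of `1/2` and `1 / α u`: integrable after squaring, with
room for the logarithm. -/
lemma tendsto_integral_variationKernel_of_one_lt (hA : DifferentiableAt ℝ A u)
    (hα : DifferentiableAt ℝ α u) (hα2 : ∀ t, α t ∈ Set.Ioo (0 : ℝ) 2) (h1 : 1 < α u) (t : ℝ) :
    Tendsto (fun r => ∫ p, min 1 (((r ^ (1 / α u))⁻¹ * variationKernel A α u (u + r * t) p) ^ 2))
      (𝓝[>] 0) (𝓝 0) := by
  have hα0 : α u ≠ 0 := (hα2 u).1.ne'
  have hinv : 1 / 2 < 1 / α u := one_div_lt_one_div_of_lt (hα2 u).1 (hα2 u).2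
  have hlt1 : 1 / α u < 1 := by rw [div_lt_one (hα2 u).1]; exact h1
  obtain ⟨C, hC⟩ := eventually_abs_variationKernel_le hA hα hα0
    (q := (1 / 2 + 1 / α u) / 2) (by linarith) t
  have hsplit : ∀ r : ℝ, 0 < r → (r ^ (1 / α u))⁻¹ * r = r ^ (1 - 1 / α u) := by
    intro r hr
    rw [← Real.rpow_neg hr.le, ← Real.rpow_add_one hr.ne']
    ring_nf
  refine tendsto_integral_min_one_sq_of_decay (K := |u| + 1) (C := C)
    (q := (1 / 2 + 1 / α u) / 2) (by linarith)
    (fun r => ((isSymmetricKernel_variationKernel hα2 A u _).const_mul _).measurable) ?_ ?_ ?_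
  · filter_upwards [eventually_variationKernel_eq_zero u t] with r h x y hx
    rw [h x y hx, mul_zero]
  · filter_upwards [hC, self_mem_nhdsWithin, (Ioo_mem_nhdsGT (zero_lt_one (α := ℝ)))]
      with r h hr hr1 x y hy
    have hr' : 0 < r := hr
    have h2 := h x y hy
    have h3 : 0 ≤ C * |y| ^ (-((1 / 2 + 1 / α u) / 2)) :=
      nonneg_of_mul_nonneg_right ((abs_nonneg _).trans h2) hr'
    have h4 : 0 < r ^ (1 / α u) := Real.rpow_pos_of_pos hr' _
    rw [abs_mul, abs_of_pos (inv_pos.2 h4)]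
    calc (r ^ (1 / α u))⁻¹ * |variationKernel A α u (u + r * t) (x, y)|
        ≤ (r ^ (1 / α u))⁻¹ * (r * (C * |y| ^ (-((1 / 2 + 1 / α u) / 2)))) := by gcongr
      _ = r ^ (1 - 1 / α u) * (C * |y| ^ (-((1 / 2 + 1 / α u) / 2))) := by
          rw [← mul_assoc, hsplit r hr']
      _ ≤ _ := mul_le_of_le_one_left h3 (Real.rpow_le_one hr'.le hr1.2.le (by linarith))
  · have hy : ∀ᵐ p : ℝ × ℝ, p.2 ≠ 0 := by
      rw [Measure.volume_eq_prod]
      exact Measure.quasiMeasurePreserving_snd.ae (Measure.ae_ne volume (0 : ℝ))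
    filter_upwards [hy] with p hp
    have h2 := tendsto_div_mul_signedPow_sub hA hα hα0 hp t
    have h3 : Tendsto (fun r : ℝ => r ^ (1 - 1 / α u)) (𝓝[>] 0) (𝓝 0) := by
      have := (Real.continuousAt_rpow_const 0 (1 - 1 / α u) (Or.inr (by linarith))).tendsto
      rw [Real.zero_rpow (by linarith)] at this
      exact this.mono_left nhdsWithin_le_nhds
    have h4 := h3.mul h2
    rw [zero_mul] at h4
    refine squeeze_zero_norm' ?_ (by simpa only [norm_zero] using h4.norm)
    filter_upwards [self_mem_nhdsWithin] with r hr
    rw [variationKernel_eq, mul_left_comm, norm_mul]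
    refine (mul_le_of_le_one_left (norm_nonneg _) (abs_orientedIndicator_le _ _)).trans ?_
    rw [← hsplit r hr]
    refine le_of_eq (congrArg _ ?_)
    have : r ≠ 0 := (show (0 : ℝ) < r from hr).ne'
    field_simp

end

/-! ### Convergence in probability and increments of the Lévy kernel. -/

lemma tendstoInMeasure_pi {Ω κ ι : Type*} [MeasurableSpace Ω] {P : Measure Ω} [Fintype ι]
    {l : Filter κ} {f : κ → Ω → ι → ℝ} {g : Ω → ι → ℝ}
    (h : ∀ i, TendstoInMeasure P (fun r ω => f r ω i) l (fun ω => g ω i)) :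
    TendstoInMeasure P f l g := by
  rw [tendstoInMeasure_iff_norm]
  intro ε hε
  have h1 : Tendsto (fun r => ∑ i, P {ω | ε ≤ ‖f r ω i - g ω i‖}) l (𝓝 0) := by
    have := tendsto_finsetSum Finset.univ fun i _ => tendstoInMeasure_iff_norm.1 (h i) ε hε
    simpa using this
  refine tendsto_of_tendsto_of_tendsto_of_le_of_le tendsto_const_nhds h1 (fun _ => zero_le)
    fun r => ?_
  refine (measure_mono fun ω hω => ?_).trans (measure_iUnion_fintype_le P _)
  rw [Set.mem_iUnion]
  by_contra! h2
  simp only [Set.mem_ofPred_eq, not_le] at h2 hω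
  exact absurd ((pi_norm_lt_iff hε).2 h2) (not_lt.2 hω)

lemma tendsto_integral_min_one_sq_add {κ : Type*} {l : Filter κ} {f g : κ → ℝ × ℝ → ℝ}
    (hf : ∀ r, IsSymmetricKernel (f r)) (hg : ∀ r, IsSymmetricKernel (g r))
    (hf0 : Tendsto (fun r => ∫ p, min 1 (f r p ^ 2)) l (𝓝 0))
    (hg0 : Tendsto (fun r => ∫ p, min 1 (g r p ^ 2)) l (𝓝 0)) :
    Tendsto (fun r => ∫ p, min 1 ((f r p + g r p) ^ 2)) l (𝓝 0) := by
  have h := (hf0.add hg0).const_mul 2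
  rw [add_zero, mul_zero] at h
  refine squeeze_zero (fun r => integral_nonneg fun p => min_one_sq_nonneg _) (fun r => ?_) h
  rw [← integral_add (hf r).integrable (hg r).integrable, ← integral_const_mul]
  exact integral_mono ((hf r).add (hg r)).integrable
    (((hf r).integrable.add (hg r).integrable).const_mul 2) fun p => min_one_sq_add_le _ _

section Kernels

variable {β : ℝ}

lemma isSymmetricKernel_levyKernel_sub (hβ : β ∈ Set.Ioo (0 : ℝ) 2) (c s t : ℝ) :
    IsSymmetricKernel fun p => c * (levyKernel β t p - levyKernel β s p) :=
  ((isSymmetricKernel_levyKernel hβ t).sub (isSymmetricKernel_levyKernel hβ s)).const_mul c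

lemma mul_levyKernel_sub_eq (β c s t : ℝ) (p : ℝ × ℝ) :
    c * (levyKernel β t p - levyKernel β s p) =
      c * (orientedIndicator t p.1 - orientedIndicator s p.1) * signedPow p.2 (-1 / β) := by
  simp only [levyKernel]; ring

lemma integral_abs_orientedIndicator_sub_rpow (hβ : 0 < β) (s t : ℝ) :
    ∫ x, |orientedIndicator t x - orientedIndicator s x| ^ β = |t - s| := by
  wlog h : s ≤ t generalizing s t
  · rw [abs_sub_comm t, ← this t s (le_of_not_ge h)]
    simp only [abs_sub_comm]
  have h1 : ∫ x, |orientedIndicator t x - orientedIndicator s x| ^ β =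
      ∫ x, (Set.Ioo s t).indicator 1 x := by
    refine integral_congr_ae ?_
    filter_upwards [Measure.ae_ne volume (0 : ℝ), Measure.ae_ne volume s,
      Measure.ae_ne volume t] with x h0 hs ht
    rw [orientedIndicator_sub h0 hs ht, Set.Ioo_eq_empty (not_lt.2 h)]
    by_cases hx : x ∈ Set.Ioo s t
    · simp [hx]
    · simp [hx, Real.zero_rpow hβ.ne']
  rw [h1, integral_indicator_one measurableSet_Ioo, Real.volume_real_Ioo_of_le h,
    abs_of_nonneg (sub_nonneg.2 h)]

/-- Scaling of the increments of the indicators around `u`. -/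
lemma integral_abs_sum_orientedIndicator_rpow (β : ℝ) {ι : Type*} [Fintype ι]
    (θ t : ι → ℝ) (c u : ℝ) {r : ℝ} (hr : 0 < r) :
    ∫ x, |∑ i, θ i * (c * (orientedIndicator (u + r * t i) x - orientedIndicator u x))| ^ β =
      r * |c| ^ β * ∫ x, |∑ i, θ i * orientedIndicator (t i) x| ^ β := by
  rw [integral_comp_affine (fun x => |∑ i, θ i *
    (c * (orientedIndicator (u + r * t i) x - orientedIndicator u x))| ^ β) u hr, mul_assoc,
    ← integral_const_mul (|c| ^ β)]
  congr 1
  refine integral_congr_ae ?_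
  filter_upwards [ae_all_iff.2 fun i => ae_orientedIndicator_sub_comp u (t i) hr] with x hx
  simp only [hx]
  rw [← Real.mul_rpow (abs_nonneg _) (abs_nonneg _), ← abs_mul, Finset.mul_sum]
  congr 2
  exact Finset.sum_congr rfl fun i _ => by ring

lemma integral_one_sub_cos_levyKernel_sub (hβ : β ∈ Set.Ioo (0 : ℝ) 2) {ι : Type*} [Fintype ι]
    (θ s t : ι → ℝ) (c : ℝ) :
    ∫ p, (1 - Real.cos (∑ i, θ i * (c * (levyKernel β (t i) p - levyKernel β (s i) p)))) =
      stableIntegral β *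
        ∫ x, |∑ i, θ i * (c * (orientedIndicator (t i) x - orientedIndicator (s i) x))| ^ β := by
  set k : ℝ → ℝ := fun x =>
    ∑ i, θ i * (c * (orientedIndicator (t i) x - orientedIndicator (s i) x)) with hk'
  have h : ∀ p : ℝ × ℝ, ∑ i, θ i * (c * (levyKernel β (t i) p - levyKernel β (s i) p)) =
      k p.1 * signedPow p.2 (-1 / β) := by
    intro p
    simp only [mul_levyKernel_sub_eq, hk', Finset.sum_mul, mul_assoc]
  have hk := IsSymmetricKernel.sum Finset.univ fun i =>
    (isSymmetricKernel_levyKernel_sub hβ c (s i) (t i)).const_mul (θ i)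
  simp only [h] at hk ⊢
  exact IsSymmetricKernel.integral_one_sub_cos_spatial hβ.1 hk

lemma apply_sum_of_pairwise {ι : Type*} [Fintype ι] {φ : ℝ → ℝ} (hφ : φ 0 = 0) {f : ι → ℝ}
    (h : ∀ i j, i ≠ j → f i = 0 ∨ f j = 0) : φ (∑ i, f i) = ∑ i, φ (f i) := by
  by_cases h0 : ∀ i, f i = 0
  · simp [h0, hφ]
  · push Not at h0
    obtain ⟨i, hi⟩ := h0
    have h1 : ∀ j, j ≠ i → f j = 0 := fun j hj => (h i j hj.symm).resolve_left hi
    rw [Finset.sum_eq_single i (fun j _ hj => h1 j hj) (by simp),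
      Finset.sum_eq_single i (fun j _ hj => by rw [h1 j hj, hφ]) (by simp)]

/-- Successive time intervals are disjoint, so almost every point contributes to at most one
increment. With `apply_sum_of_pairwise` this makes the exponent additive. -/
lemma ae_levyKernel_sub_eq_zero_or {n : ℕ} {t : Fin (n + 1) → ℝ} (ht : Monotone t) (β c : ℝ) :
    ∀ᵐ p, ∀ i j : Fin n, i ≠ j →
      c * (levyKernel β (t i.succ) p - levyKernel β (t i.castSucc) p) = 0 ∨
      c * (levyKernel β (t j.succ) p - levyKernel β (t j.castSucc) p) = 0 := by
  have hx : ∀ a : ℝ, ∀ᵐ p : ℝ × ℝ, p.1 ≠ a := by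
    intro a
    rw [Measure.volume_eq_prod]
    exact Measure.quasiMeasurePreserving_fst.ae (Measure.ae_ne volume a)
  filter_upwards [hx 0, ae_all_iff.2 fun i => hx (t i)] with p h0 h1 i j hij
  have key : ∀ i : Fin n, p.1 ∉ Set.Ioo (t i.castSucc) (t i.succ) →
      c * (levyKernel β (t i.succ) p - levyKernel β (t i.castSucc) p) = 0 := by
    intro i hi
    rw [mul_levyKernel_sub_eq, orientedIndicator_sub h0 (h1 _) (h1 _),
      Set.indicator_of_notMem hi, Set.Ioo_eq_empty (not_lt.2 (ht i.castSucc_le_succ))]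
    simp
  wlog hlt : i < j generalizing i j
  · exact (this j i hij.symm (lt_of_le_of_ne (not_lt.1 hlt) hij.symm)).symm
  by_cases hi : p.1 ∈ Set.Ioo (t i.castSucc) (t i.succ)
  · right
    refine key j fun hj => ?_
    have h2 : t i.succ ≤ t j.castSucc := ht (by
      rw [Fin.le_def]
      simpa using Nat.succ_le_of_lt (Fin.lt_def.1 hlt))
    linarith [hi.2, hj.1]
  · exact Or.inl (key i hi)

end Kernels

/-- The kernel at time `0` lives on the null line `x = 0`, which almost surely carries no points. -/
lemma ae_poissonSum_levyKernel_zero {Ω : Type*} [MeasurableSpace Ω] {P : Measure Ω}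
    {S : Ω → Set (ℝ × ℝ)} {E : ℕ → Set ℝ} (hS : IsPoissonProcess S volume P) (β : ℝ) :
    ∀ᵐ ω ∂P, poissonSum E (levyKernel β 0) (S ω) = 0 := by
  have hm : MeasurableSet {p : ℝ × ℝ | p.1 = 0} := measurable_fst (measurableSet_singleton 0)
  have h0 : volume {p : ℝ × ℝ | p.1 = 0} = 0 := by
    rw [Measure.volume_eq_prod]
    have h := Measure.quasiMeasurePreserving_fst (μ := (volume : Measure ℝ))
      (ν := (volume : Measure ℝ)) |>.ae (Measure.ae_ne volume (0 : ℝ))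
    simpa [ae_iff] using h
  filter_upwards [hS.ae_disjoint hm h0] with ω hω
  have h1 : partialSum E (levyKernel β 0) (S ω) = fun _ => 0 := by
    funext n
    refine (tsum_congr fun p => ?_).trans tsum_zero
    have h2 : (p : ℝ × ℝ).1 ≠ 0 := fun h => by
      have h3 : (p : ℝ × ℝ) ∈ S ω ∩ {p : ℝ × ℝ | p.1 = 0} := ⟨p.2.1, h⟩
      rw [hω] at h3
      exact h3
    rw [levyKernel, orientedIndicator_zero h2, zero_mul]
  rw [poissonSum, h1]
  exact tendsto_const_nhds.limUnder_eq

/-! ### The symmetric stable Lévy motion. -/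

section StableLevy

variable {Ω : Type*} [MeasurableSpace Ω] {P : Measure Ω} [IsProbabilityMeasure P]
  {S : Ω → Set (ℝ × ℝ)} {E : ℕ → Set ℝ} {β : ℝ}

lemma ae_mul_poissonSum_levyKernel_sub (hS : IsPoissonProcess S volume P) (hE : IsExhaustion E)
    (hβ : β ∈ Set.Ioo (0 : ℝ) 2) (c s t : ℝ) :
    ∀ᵐ ω ∂P, poissonSum E (fun p => c * (levyKernel β t p - levyKernel β s p)) (S ω) =
      c * (poissonSum E (levyKernel β t) (S ω) - poissonSum E (levyKernel β s) (S ω)) := by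
  have ht := isSymmetricKernel_levyKernel hβ t
  have hs := isSymmetricKernel_levyKernel hβ s
  filter_upwards [(ht.sub hs).ae_poissonSum_const_mul hS hE c, ht.ae_poissonSum_sub hs hS hE]
    with ω h1 h2
  rw [h1, h2]

lemma ae_stableLevy_sub (hS : IsPoissonProcess S volume P) (hE : IsExhaustion E)
    (hβ : β ∈ Set.Ioo (0 : ℝ) 2) (s t : ℝ) :
    ∀ᵐ ω ∂P, stableLevy S E β t ω - stableLevy S E β s ω =
      poissonSum E (fun p => stableConst β * (levyKernel β t p - levyKernel β s p)) (S ω) := by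
  filter_upwards [ae_mul_poissonSum_levyKernel_sub hS hE hβ (stableConst β) s t] with ω h
  rw [h, stableLevy, stableLevy, mul_sub]

lemma aemeasurable_stableLevy (hS : IsPoissonProcess S volume P) (hE : IsExhaustion E)
    (hβ : β ∈ Set.Ioo (0 : ℝ) 2) (t : ℝ) : AEMeasurable (stableLevy S E β t) P :=
  ((isSymmetricKernel_levyKernel hβ t).aemeasurable_poissonSum hS hE).const_mul _

lemma isSymmetricStableLevyMotion_stableLevy (hS : IsPoissonProcess S volume P)
    (hE : IsExhaustion E) (hβ : β ∈ Set.Ioo (0 : ℝ) 2) (hβ1 : β ≠ 1) :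
    IsSymmetricStableLevyMotion β (stableLevy S E β) P where
  aemeasurable := aemeasurable_stableLevy hS hE hβ
  zero := by
    filter_upwards [ae_poissonSum_levyKernel_zero hS β] with ω hω
    rw [stableLevy, hω, mul_zero]
  indepIncrements := by
    intro n t ht
    set k : Fin n → ℝ × ℝ → ℝ := fun i p =>
      stableConst β * (levyKernel β (t i.succ) p - levyKernel β (t i.castSucc) p) with hk
    have hsym : ∀ i, IsSymmetricKernel (k i) := fun i =>
      isSymmetricKernel_levyKernel_sub hβ _ _ _
    refine iIndepFun.congr (fun i => ?_)
      (IsSymmetricKernel.iIndepFun_poissonSum hS hE hsym fun θ => ?_)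
    · filter_upwards [ae_stableLevy_sub hS hE hβ (t i.castSucc) (t i.succ)] with ω hω
      exact hω.symm
    · rw [← integral_finsetSum _ fun i _ => ((hsym i).const_mul (θ i)).integrable_one_sub_cos]
      refine integral_congr_ae ?_
      filter_upwards [ae_levyKernel_sub_eq_zero_or ht β (stableConst β)] with p hp
      refine apply_sum_of_pairwise (φ := fun x => 1 - Real.cos x) (by simp) fun i j hij => ?_
      rcases hp i j hij with h | h
      · exact Or.inl (by simp only [hk, h, mul_zero])
      · exact Or.inr (by simp only [hk, h, mul_zero])
  charFun_increment := by
    intro s t θ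
    rw [Measure.map_congr (ae_stableLevy_sub hS hE hβ s t),
      (isSymmetricKernel_levyKernel_sub hβ _ _ _).charFun_map_poissonSum hS hE]
    have h := integral_one_sub_cos_levyKernel_sub hβ (fun _ : Unit => θ) (fun _ => s) (fun _ => t)
      (stableConst β)
    simp only [Finset.univ_unique, Finset.sum_singleton] at h
    have hc := stableConst_pos hβ hβ1
    have h2 : ∀ x, |θ * (stableConst β * (orientedIndicator t x - orientedIndicator s x))| ^ β =
        |θ| ^ β * stableConst β ^ β * |orientedIndicator t x - orientedIndicator s x| ^ β := by
      intro x
      rw [abs_mul, abs_mul, abs_of_pos hc, Real.mul_rpow (abs_nonneg _) (by positivity),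
        Real.mul_rpow hc.le (abs_nonneg _), mul_assoc]
    simp only [h2] at h
    rw [integral_const_mul, integral_abs_orientedIndicator_sub_rpow hβ.1] at h
    rw [h]
    congr 3
    have h3 := stableIntegral_mul_stableConst_rpow hβ hβ1
    linear_combination (|θ| ^ β * |t - s|) * h3

end StableLevy

/-! ### The tangent kernel. -/

section Tangent

variable {a α : ℝ → ℝ} {u : ℝ}

lemma tangentKernel_eq (a α : ℝ → ℝ) (u : ℝ) (p : ℝ × ℝ) :
    tangentKernel a α u p = orientedIndicator u p.1 * (signedPow p.2 (-1 / α u) *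
      (a u * stableConst (α u) * (deriv α u / α u ^ 2) * Real.log |p.2| +
        deriv (fun v => a v * stableConst (α v)) u)) := by
  simp only [tangentKernel, levyKernel]; ring

lemma measurable_tangentKernel (a α : ℝ → ℝ) (u : ℝ) : Measurable (tangentKernel a α u) := by
  have h1 := (measurable_orientedIndicator u).comp (measurable_fst : Measurable (Prod.fst : ℝ × ℝ → ℝ))
  have h2 := (measurable_signedPow (-1 / α u)).comp (measurable_snd : Measurable (Prod.snd : ℝ × ℝ → ℝ))
  have h3 : Measurable fun p : ℝ × ℝ => Real.log |p.2| :=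
    Real.measurable_log.comp (continuous_abs.measurable.comp measurable_snd)
  exact (h1.mul h2).mul ((h3.const_mul _).add_const _)

lemma tangentKernel_neg (a α : ℝ → ℝ) (u x y : ℝ) :
    tangentKernel a α u (x, -y) = -tangentKernel a α u (x, y) := by
  simp [tangentKernel_eq, signedPow_neg]

lemma tangentKernel_eq_zero {x : ℝ} (hx : |u| < |x|) (y : ℝ) : tangentKernel a α u (x, y) = 0 := by
  rw [tangentKernel_eq, orientedIndicator_eq_zero hx, zero_mul]

lemma exists_abs_tangentKernel_le (a α : ℝ → ℝ) (u : ℝ) {q : ℝ} (hq : q < 1 / α u) :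
    ∃ C, ∀ x y, 1 ≤ |y| → |tangentKernel a α u (x, y)| ≤ C * |y| ^ (-q) := by
  set D := a u * stableConst (α u) * (deriv α u / α u ^ 2)
  set B := deriv (fun v => a v * stableConst (α v)) u
  set ε := 1 / α u - q with hε
  have hε0 : 0 < ε := sub_pos.2 hq
  refine ⟨|D| / ε + |B|, fun x y hy => ?_⟩
  have hy0 : 0 < |y| := by linarith
  rw [tangentKernel_eq, abs_mul]
  refine (mul_le_of_le_one_left (abs_nonneg _) (abs_orientedIndicator_le _ _)).trans ?_
  have e1 : 1 ≤ |y| ^ ε := Real.one_le_rpow hy hε0.le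
  have e2 := Real.log_le_rpow_div hy0.le hε0
  have e3 : 0 ≤ Real.log |y| := Real.log_nonneg hy
  have e4 : |D * Real.log |y| + B| ≤ (|D| / ε + |B|) * |y| ^ ε := by
    refine (abs_add_le _ _).trans ?_
    rw [abs_mul, abs_of_nonneg e3]
    have := mul_le_mul_of_nonneg_left e2 (abs_nonneg D)
    have h2 := mul_le_mul_of_nonneg_left e1 (abs_nonneg B)
    calc |D| * Real.log |y| + |B| ≤ |D| * (|y| ^ ε / ε) + |B| * |y| ^ ε := by linarith
      _ = _ := by ring
  rw [abs_mul]
  calc |signedPow y (-1 / α u)| * |D * Real.log |y| + B|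
      ≤ |y| ^ (-1 / α u) * ((|D| / ε + |B|) * |y| ^ ε) :=
        mul_le_mul (abs_signedPow_le _ _) e4 (abs_nonneg _) (Real.rpow_nonneg hy0.le _)
    _ = (|D| / ε + |B|) * (|y| ^ (-1 / α u) * |y| ^ ε) := by ring
    _ = _ := by
        rw [← Real.rpow_add hy0, hε]
        congr 2
        ring

lemma isSymmetricKernel_tangentKernel (a : ℝ → ℝ) (h0 : 0 < α u) (h2 : α u < 2) :
    IsSymmetricKernel (tangentKernel a α u) := by
  have hinv : 1 / 2 < 1 / α u := one_div_lt_one_div_of_lt h0 h2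
  obtain ⟨C, hC⟩ := exists_abs_tangentKernel_le a α u (q := (1 / 2 + 1 / α u) / 2) (by linarith)
  exact isSymmetricKernel_of_decay (K := |u|) (measurable_tangentKernel a α u)
    (tangentKernel_neg a α u) (by linarith) (fun x y hx => tangentKernel_eq_zero hx y) hC

lemma sumConvergesAbsolutely_tangentKernel {Ω : Type*} [MeasurableSpace Ω] {P : Measure Ω}
    [IsProbabilityMeasure P] {S : Ω → Set (ℝ × ℝ)} {E : ℕ → Set ℝ}
    (hS : IsPoissonProcess S volume P) (hE : IsExhaustion E) (a : ℝ → ℝ) (h0 : 0 < α u)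
    (h1 : α u < 1) : SumConvergesAbsolutely S E (tangentKernel a α u) P := by
  have hinv : 1 < 1 / α u := by rwa [lt_div_iff₀ h0, one_mul]
  obtain ⟨C, hC⟩ := exists_abs_tangentKernel_le a α u (q := (1 + 1 / α u) / 2) (by linarith)
  exact sumConvergesAbsolutely_of_integrable hS hE (measurable_tangentKernel a α u)
    (integrable_min_one_abs_of_decay (K := |u|) (measurable_tangentKernel a α u)
    (by linarith) (fun x y hx => tangentKernel_eq_zero hx y) hC)

/-- For `log y > |B / D|` the bracket `D log y + B` cannot vanish, so the kernel is nonzero on an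
open rectangle over the interval between `0` and `u`. -/
lemma not_ae_tangentKernel_eq_zero (hu : u ≠ 0)
    (hD : a u * stableConst (α u) * (deriv α u / α u ^ 2) ≠ 0) :
    ¬ ∀ᵐ p, tangentKernel a α u p = 0 := by
  intro h
  set D := a u * stableConst (α u) * (deriv α u / α u ^ 2)
  set B := deriv (fun v => a v * stableConst (α v)) u
  set U : Set (ℝ × ℝ) := Set.Ioo (min 0 u) (max 0 u) ×ˢ Set.Ioi (Real.exp |B / D|) with hU
  have hUo : IsOpen U := isOpen_Ioo.prod isOpen_Ioi
  have hUn : U.Nonempty := by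
    refine Set.Nonempty.prod (Set.nonempty_Ioo.2 ?_) Set.nonempty_Ioi
    rcases lt_or_gt_of_ne hu with h | h
    · rw [min_eq_right h.le, max_eq_left h.le]; exact h
    · rw [min_eq_left h.le, max_eq_right h.le]; exact h
  refine (hUo.measure_pos volume hUn).ne' (measure_mono_null (fun p hp => ?_) (ae_iff.1 h))
  obtain ⟨hx, hy⟩ := hp
  have hy1 : Real.exp |B / D| < p.2 := hy
  have hy0 : 0 < p.2 := (Real.exp_pos _).trans hy1
  have hl : |B / D| < Real.log p.2 := (Real.lt_log_iff_exp_lt hy0).2 hy1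
  simp only [Set.mem_ofPred_eq]
  rw [tangentKernel_eq]
  refine mul_ne_zero ?_ (mul_ne_zero ?_ ?_)
  · rcases lt_or_gt_of_ne hu with h | h
    · rw [min_eq_right h.le, max_eq_left h.le] at hx
      rw [orientedIndicator_of_neg hx.2, if_pos hx.1.le]
      norm_num
    · rw [min_eq_left h.le, max_eq_right h.le] at hx
      rw [orientedIndicator_of_pos hx.1, if_pos hx.2.le]
      norm_num
  · rw [← abs_ne_zero, abs_signedPow hy0.ne']
    exact (Real.rpow_pos_of_pos (abs_pos.2 hy0.ne') _).ne'
  · rw [abs_of_pos hy0]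
    intro h3
    have h4 : Real.log p.2 = -(B / D) := by
      field_simp
      linarith
    rw [h4] at hl
    exact absurd hl (not_lt.2 (neg_le_abs _))

/-- The variation of the kernel, divided by `r`, is close to the tangent kernel. -/
lemma tendsto_integral_variationKernel_sub_tangentKernel
    (hA : DifferentiableAt ℝ (fun v => a v * stableConst (α v)) u)
    (hα : DifferentiableAt ℝ α u) (hα2 : ∀ t, α t ∈ Set.Ioo (0 : ℝ) 2) (t : ℝ) :
    Tendsto (fun r => ∫ p, min 1 ((r⁻¹ * variationKernel (fun v => a v * stableConst (α v)) α u
      (u + r * t) p - t * tangentKernel a α u p) ^ 2)) (𝓝[>] 0) (𝓝 0) := by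
  have hα0 : α u ≠ 0 := (hα2 u).1.ne'
  have hinv : 1 / 2 < 1 / α u := one_div_lt_one_div_of_lt (hα2 u).1 (hα2 u).2
  obtain ⟨C, hC⟩ := eventually_abs_variationKernel_le hA hα hα0
    (q := (1 / 2 + 1 / α u) / 2) (by linarith) t
  obtain ⟨C', hC'⟩ := exists_abs_tangentKernel_le a α u (q := (1 / 2 + 1 / α u) / 2) (by linarith)
  refine tendsto_integral_min_one_sq_of_decay (K := |u| + 1) (C := C + |t| * C')
    (q := (1 / 2 + 1 / α u) / 2) (by linarith)
    (fun r => (((isSymmetricKernel_variationKernel hα2 _ u _).const_mul _).measurable.sub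
      ((measurable_tangentKernel a α u).const_mul _))) ?_ ?_ ?_
  · filter_upwards [eventually_variationKernel_eq_zero u t] with r h x y hx
    rw [h x y hx, tangentKernel_eq_zero (by linarith), mul_zero, mul_zero, sub_zero]
  · filter_upwards [hC, self_mem_nhdsWithin] with r h hr x y hy
    have hr' : 0 < r := hr
    have h2 := h x y hy
    refine (abs_sub _ _).trans ?_
    rw [abs_mul, abs_mul, abs_of_pos (inv_pos.2 hr'), add_mul, mul_assoc]
    refine add_le_add ?_ (mul_le_mul_of_nonneg_left (hC' x y hy) (abs_nonneg _))
    rwa [inv_mul_le_iff₀ hr']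
  · have hx : ∀ b : ℝ, ∀ᵐ p : ℝ × ℝ, p.1 ≠ b := by
      intro b
      rw [Measure.volume_eq_prod]
      exact Measure.quasiMeasurePreserving_fst.ae (Measure.ae_ne volume b)
    have hy : ∀ᵐ p : ℝ × ℝ, p.2 ≠ 0 := by
      rw [Measure.volume_eq_prod]
      exact Measure.quasiMeasurePreserving_snd.ae (Measure.ae_ne volume (0 : ℝ))
    -- Off these null lines the indicator is constant for small `r`, so only the factor in `y` is
    -- differentiated.
    filter_upwards [hx 0, hx u, hy] with p h0 hu hp
    have h2 := tendsto_div_mul_signedPow_sub hA hα hα0 hp t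
    have h3 := (h2.const_mul (orientedIndicator u p.1)).sub_const (t * tangentKernel a α u p)
    rw [tangentKernel_eq, mul_left_comm, sub_self] at h3
    refine h3.congr' ?_
    filter_upwards [(tendsto_affine_nhdsGT u t).eventually
      (eventually_orientedIndicator_eq h0 hu)] with r hr
    rw [variationKernel_eq, hr, tangentKernel_eq]
    ring

end Tangent

/-- For `β < 1` the increments of the kernel with frozen exponent are negligible at scale `r`. -/
lemma tendsto_integral_levyKernel_sub_of_lt_one {β : ℝ} (h0 : 0 < β) (h1 : β < 1) (c u t : ℝ) :
    Tendsto (fun r => ∫ p, min 1 ((r⁻¹ * c *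
      (levyKernel β (u + r * t) p - levyKernel β u p)) ^ 2)) (𝓝[>] 0) (𝓝 0) := by
  set M := ∫ y, min 1 (signedPow y (-1 / β) ^ 2)
  set J := ∫ x, |orientedIndicator t x| ^ β
  -- An exact identity: the interval contributes `r` and the factor `r⁻¹` contributes `r^{-β}`.
  have h2 : ∀ r : ℝ, 0 < r → M * |c| ^ β * J * r ^ (1 - β) = ∫ p, min 1 ((r⁻¹ * c *
      (levyKernel β (u + r * t) p - levyKernel β u p)) ^ 2) := by
    intro r hr
    have hk := isSymmetricKernel_levyKernel_sub (β := β) ⟨h0, by linarith⟩ (r⁻¹ * c) u (u + r * t)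
    simp only [mul_levyKernel_sub_eq] at hk ⊢
    have h3 := integral_comp_spatial_mul_signedPow h0 (φ := fun x => min 1 (x ^ 2)) (by simp)
      (by simp)
      (k := fun x => r⁻¹ * c * (orientedIndicator (u + r * t) x - orientedIndicator u x))
      hk.integrable
    have h4 := integral_abs_sum_orientedIndicator_rpow β (fun _ : Unit => 1) (fun _ => t)
      (r⁻¹ * c) u hr
    simp only [Finset.univ_unique, Finset.sum_singleton, one_mul] at h4
    rw [h3, h4, abs_mul, Real.mul_rpow (abs_nonneg _) (abs_nonneg _), abs_of_pos (inv_pos.2 hr),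
      Real.inv_rpow hr.le, Real.rpow_sub hr, Real.rpow_one]
    ring
  have h5 : Tendsto (fun r : ℝ => r ^ (1 - β)) (𝓝[>] 0) (𝓝 0) := by
    have := (Real.continuousAt_rpow_const 0 (1 - β) (Or.inr (by linarith))).tendsto
    rw [Real.zero_rpow (by linarith)] at this
    exact this.mono_left nhdsWithin_le_nhds
  have h6 := h5.const_mul (M * |c| ^ β * J)
  rw [mul_zero] at h6
  refine h6.congr' ?_
  filter_upwards [self_mem_nhdsWithin] with r hr
  exact h2 r hr

/-! ### Localisability of multistable Lévy motion. -/

section Localisability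

variable {Ω : Type*} [MeasurableSpace Ω] {P : Measure Ω} [IsProbabilityMeasure P]
  {S : Ω → Set (ℝ × ℝ)} {E : ℕ → Set ℝ} {a α : ℝ → ℝ}

lemma aemeasurable_multistableLevy (hS : IsPoissonProcess S volume P) (hE : IsExhaustion E)
    (hα : ∀ t, α t ∈ Set.Ioo (0 : ℝ) 2) (a : ℝ → ℝ) (t : ℝ) :
    AEMeasurable (multistableLevy S E a α t) P :=
  ((isSymmetricKernel_levyKernel (hα t) t).aemeasurable_poissonSum hS hE).const_mul _

lemma aemeasurable_scaled_increment (hS : IsPoissonProcess S volume P) (hE : IsExhaustion E)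
    (hα : ∀ t, α t ∈ Set.Ioo (0 : ℝ) 2) (a : ℝ → ℝ) (h u : ℝ) {n : ℕ} (t : Fin n → ℝ) (r : ℝ) :
    AEMeasurable (fun ω i => (multistableLevy S E a α (u + r * t i) ω -
      multistableLevy S E a α u ω) / r ^ h) P :=
  aemeasurable_pi_lambda _ fun i => ((aemeasurable_multistableLevy hS hE hα a _).sub
    (aemeasurable_multistableLevy hS hE hα a u)).div_const _

/-- Decomposition of the increments of `Y`. -/
lemma ae_multistableLevy_sub (hS : IsPoissonProcess S volume P) (hE : IsExhaustion E)
    (hα : ∀ t, α t ∈ Set.Ioo (0 : ℝ) 2) (a : ℝ → ℝ) (u v c : ℝ) :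
    ∀ᵐ ω ∂P, c * (multistableLevy S E a α v ω - multistableLevy S E a α u ω) =
      poissonSum E (fun p => c * (a u * stableConst (α u)) *
        (levyKernel (α u) v p - levyKernel (α u) u p)) (S ω) +
      poissonSum E (fun p => c *
        variationKernel (fun v => a v * stableConst (α v)) α u v p) (S ω) := by
  have hv := isSymmetricKernel_levyKernel (hα v) v
  have hu := isSymmetricKernel_levyKernel (hα u) v
  filter_upwards [ae_mul_poissonSum_levyKernel_sub hS hE (hα u) (c * (a u * stableConst (α u))) u v,
    (isSymmetricKernel_variationKernel hα _ u v).ae_poissonSum_const_mul hS hE c,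
    (hv.const_mul (a v * stableConst (α v))).ae_poissonSum_sub
      (hu.const_mul (a u * stableConst (α u))) hS hE,
    hv.ae_poissonSum_const_mul hS hE (a v * stableConst (α v)),
    hu.ae_poissonSum_const_mul hS hE (a u * stableConst (α u))] with ω h1 h2 h3 h4 h5
  rw [h1, h2]
  unfold variationKernel
  rw [h3, h4, h5, multistableLevy, multistableLevy]
  ring

/-- By self-similarity the rescaled frozen part has the law of the limit for each `r > 0`; adding
the variation part, which tends to `0` in probability, does not change the limit in law. -/
lemma hasScalingLimit_of_one_lt (hS : IsPoissonProcess S volume P) (hE : IsExhaustion E)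
    (hα : ∀ t, α t ∈ Set.Ioo (0 : ℝ) 2) {u : ℝ}
    (hA : DifferentiableAt ℝ (fun v => a v * stableConst (α v)) u)
    (hαd : DifferentiableAt ℝ α u) (h1 : 1 < α u) :
    HasScalingLimit (multistableLevy S E a α) (1 / α u) u
      (fun t ω => a u * stableLevy S E (α u) t ω) P P := by
  intro n t
  set c : ℝ → ℝ := fun r => (r ^ (1 / α u))⁻¹ with hc
  set A := a u * stableConst (α u) with hAdef
  -- For `r ≤ 0` the limit itself is inserted, so that the law is the same for all `r`.
  set X : ℝ → Ω → Fin n → ℝ := fun r ω i => if 0 < r then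
    poissonSum E (fun p => c r * A * (levyKernel (α u) (u + r * t i) p - levyKernel (α u) u p))
      (S ω) else a u * stableLevy S E (α u) (t i) ω with hX
  have hZm : AEMeasurable (fun ω (i : Fin n) => a u * stableLevy S E (α u) (t i) ω) P :=
    aemeasurable_pi_lambda _ fun i => (aemeasurable_stableLevy hS hE (hα u) (t i)).const_mul _
  have hident : ∀ r, IdentDistrib (X r) (fun ω i => a u * stableLevy S E (α u) (t i) ω) P P := by
    intro r
    by_cases hr : 0 < r
    · simp only [hX, if_pos hr]
      have h2 := IsSymmetricKernel.identDistrib_poissonSum hS hE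
        (k := fun i p => c r * A * (levyKernel (α u) (u + r * t i) p - levyKernel (α u) u p))
        (l := fun i p => A * (levyKernel (α u) (t i) p - levyKernel (α u) 0 p))
        (fun _ => isSymmetricKernel_levyKernel_sub (hα u) _ _ _)
        (fun _ => isSymmetricKernel_levyKernel_sub (hα u) _ _ _) (fun θ => by
          rw [integral_one_sub_cos_levyKernel_sub (hα u) θ (fun _ => u) (fun i => u + r * t i),
            integral_one_sub_cos_levyKernel_sub (hα u) θ (fun _ => 0) t,
            integral_abs_sum_orientedIndicator_rpow (α u) θ t _ u hr]
          have h3 := integral_abs_sum_orientedIndicator_rpow (α u) θ t A 0 one_pos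
          simp only [zero_add, one_mul] at h3
          rw [h3]
          have h4 : r * |c r * A| ^ α u = |A| ^ α u := by
            have h5 : 0 < r ^ (1 / α u) := Real.rpow_pos_of_pos hr _
            rw [abs_mul, Real.mul_rpow (abs_nonneg _) (abs_nonneg _), hc, abs_of_pos (inv_pos.2 h5),
              Real.inv_rpow h5.le, ← Real.rpow_mul hr.le, one_div_mul_cancel (hα u).1.ne',
              Real.rpow_one, ← mul_assoc, mul_inv_cancel₀ hr.ne', one_mul]
          rw [h4])
      refine h2.trans (IdentDistrib.of_ae_eq ?_ ?_)
      · exact aemeasurable_pi_lambda _ fun _ =>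
          (isSymmetricKernel_levyKernel_sub (hα u) _ _ _).aemeasurable_poissonSum hS hE
      · filter_upwards [ae_all_iff.2 fun i =>
          ae_mul_poissonSum_levyKernel_sub hS hE (hα u) A 0 (t i),
          ae_poissonSum_levyKernel_zero (E := E) hS (α u)] with ω h6 h7
        funext i
        rw [h6 i, h7, sub_zero, stableLevy, hAdef, mul_assoc]
    · simp only [hX, if_neg hr]
      exact IdentDistrib.refl hZm
  refine tendstoInDistribution_of_tendstoInMeasure_sub (X := X) _ _
    (tendstoInDistribution_of_identDistrib 0 (fun j => (hident 0).trans (hident j).symm)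
      (hident 0)) ?_ (aemeasurable_scaled_increment hS hE hα a _ u t)
  refine tendstoInMeasure_pi fun i => ?_
  refine TendstoInMeasure.congr' ?_ EventuallyEq.rfl
    (IsSymmetricKernel.tendstoInMeasure_poissonSum hS hE
      (k := fun r p => c r * variationKernel (fun v => a v * stableConst (α v)) α u
        (u + r * t i) p)
      (fun r => (isSymmetricKernel_variationKernel hα _ u _).const_mul _)
      (tendsto_integral_variationKernel_of_one_lt hA hαd hα h1 (t i)))
  filter_upwards [self_mem_nhdsWithin] with r hr
  filter_upwards [ae_multistableLevy_sub hS hE hα a u (u + r * t i) (c r)] with ω hω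
  simp only [Pi.sub_apply, hX, if_pos (show 0 < r from hr)]
  rw [div_eq_inv_mul, hω, add_sub_cancel_left]

lemma isLocalisableAt_of_one_lt (hS : IsPoissonProcess S volume P) (hE : IsExhaustion E)
    (hα : ∀ t, α t ∈ Set.Ioo (0 : ℝ) 2) {u : ℝ} (ha : a u ≠ 0)
    (hA : DifferentiableAt ℝ (fun v => a v * stableConst (α v)) u)
    (hαd : DifferentiableAt ℝ α u) (h1 : 1 < α u) :
    IsLocalisableAt (multistableLevy S E a α) (1 / α u) u
      (fun t ω => a u * stableLevy S E (α u) t ω) P P where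
  hasScalingLimit := hasScalingLimit_of_one_lt hS hE hα hA hαd h1
  nontrivial := by
    refine ⟨1, fun h => ?_⟩
    have hL := isSymmetricStableLevyMotion_stableLevy hS hE (hα u) h1.ne'
    -- If the form vanished at time `1`, this characteristic function would be `1` instead of
    -- `e^{-1}`.
    have h2 := hL.charFun_increment 0 1 1
    have h3 : (fun ω => stableLevy S E (α u) 1 ω - stableLevy S E (α u) 0 ω) =ᵐ[P] fun _ => 0 := by
      filter_upwards [h, hL.zero] with ω h4 h5
      rw [h5, sub_zero]
      exact (mul_eq_zero.1 h4).resolve_left ha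
    rw [Measure.map_congr h3, Measure.map_const, measure_univ, one_smul, charFun_dirac] at h2
    simp only [inner_zero_left, Complex.ofReal_zero, zero_mul, Complex.exp_zero, sub_zero, abs_one,
      Real.one_rpow, mul_one] at h2
    have h6 : Real.exp (-1) = 1 := by exact_mod_cast h2.symm
    rw [Real.exp_eq_one_iff] at h6
    norm_num at h6

/-- The limit lives on the same probability space and convergence holds in probability: the frozen
part over `r` is negligible and the variation part over `r` approaches the sum of the tangent
kernel. -/
lemma hasScalingLimit_of_lt_one (hS : IsPoissonProcess S volume P) (hE : IsExhaustion E)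
    (hα : ∀ t, α t ∈ Set.Ioo (0 : ℝ) 2) {u : ℝ}
    (hA : DifferentiableAt ℝ (fun v => a v * stableConst (α v)) u)
    (hαd : DifferentiableAt ℝ α u) (h1 : α u < 1) :
    HasScalingLimit (multistableLevy S E a α) 1 u
      (fun t ω => t * tangentVariable S E a α u ω) P P := by
  intro n t
  refine TendstoInMeasure.tendstoInDistribution (tendstoInMeasure_pi fun i => ?_)
    (aemeasurable_scaled_increment hS hE hα a 1 u t)
  have hT := isSymmetricKernel_tangentKernel (u := u) a (hα u).1 (hα u).2
  have hV : ∀ r, IsSymmetricKernel fun p => r⁻¹ *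
      variationKernel (fun v => a v * stableConst (α v)) α u (u + r * t i) p :=
    fun r => (isSymmetricKernel_variationKernel hα _ u _).const_mul _
  have hL : ∀ r, IsSymmetricKernel fun p => r⁻¹ * (a u * stableConst (α u)) *
      (levyKernel (α u) (u + r * t i) p - levyKernel (α u) u p) :=
    fun r => isSymmetricKernel_levyKernel_sub (hα u) _ _ _
  have m := (IsSymmetricKernel.tendstoInMeasure_poissonSum hS hE
    (fun r => (hL r).add ((hV r).sub (hT.const_mul (t i))))
    (tendsto_integral_min_one_sq_add hL (fun r => (hV r).sub (hT.const_mul (t i)))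
      (tendsto_integral_levyKernel_sub_of_lt_one (hα u).1 h1 (a u * stableConst (α u)) u (t i))
      (tendsto_integral_variationKernel_sub_tangentKernel hA hαd hα (t i)))).congr'
    (f' := fun r ω => (multistableLevy S E a α (u + r * t i) ω -
      multistableLevy S E a α u ω) / r ^ (1 : ℝ) - t i * tangentVariable S E a α u ω) (g' := 0) (by
      filter_upwards with r
      filter_upwards [ae_multistableLevy_sub hS hE hα a u (u + r * t i) r⁻¹,
        (hL r).ae_poissonSum_add ((hV r).sub (hT.const_mul (t i))) hS hE,
        (hV r).ae_poissonSum_sub (hT.const_mul (t i)) hS hE,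
        hT.ae_poissonSum_const_mul hS hE (t i)] with ω h2 h3 h4 h5
      rw [Real.rpow_one, div_eq_inv_mul, h2, h3, h4, h5, tangentVariable]
      ring) EventuallyEq.rfl
  rw [tendstoInMeasure_iff_norm] at m ⊢
  simpa only [Pi.zero_apply, sub_zero] using m

lemma isLocalisableAt_of_lt_one (hS : IsPoissonProcess S volume P) (hE : IsExhaustion E)
    (hα : ∀ t, α t ∈ Set.Ioo (0 : ℝ) 2) {u : ℝ} (ha : a u ≠ 0)
    (hA : DifferentiableAt ℝ (fun v => a v * stableConst (α v)) u)
    (hαd : DifferentiableAt ℝ α u) (h1 : α u < 1) (hα' : deriv α u ≠ 0) (hu : u ≠ 0) :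
    IsLocalisableAt (multistableLevy S E a α) 1 u
      (fun t ω => t * tangentVariable S E a α u ω) P P where
  hasScalingLimit := hasScalingLimit_of_lt_one hS hE hα hA hαd h1
  nontrivial := by
    refine ⟨1, fun h => ?_⟩
    simp only [one_mul] at h
    have hα0 := (hα u).1.ne'
    refine not_ae_tangentKernel_eq_zero hu (mul_ne_zero (mul_ne_zero ha
      (stableConst_pos (hα u) h1.ne).ne') (div_ne_zero hα' (pow_ne_zero 2 hα0)))
      ((isSymmetricKernel_tangentKernel a (hα u).1 (hα u).2).ae_eq_zero_of_poissonSum hS hE h)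

end Localisability

end Multistable

theorem theorem9p4 {Ω : Type*} [MeasurableSpace Ω] (P : Measure Ω) [IsProbabilityMeasure P]
    (S : Ω → Set (ℝ × ℝ)) (hS : Multistable.IsPoissonProcess S (volume : Measure (ℝ × ℝ)) P)
    (E : ℕ → Set ℝ) (hE : Multistable.IsExhaustion E)
    (α a : ℝ → ℝ) (hα : ∀ t, α t ∈ Set.Ioo (0 : ℝ) 2) (hα1 : ContDiff ℝ 1 α)
    (ha : ∀ t, 0 < a t) (ha1 : ContDiff ℝ 1 a) :
    -- the Poisson sums defining the processes converge
    (∀ β ∈ Set.Ioo (0 : ℝ) 2, ∀ t : ℝ,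
      Multistable.SumConverges S E (Multistable.levyKernel β t) P ∧
      (β < 1 → Multistable.SumConvergesAbsolutely S E (Multistable.levyKernel β t) P)) ∧
    -- part (a)
    (∀ u : ℝ, 1 < α u →
      Multistable.IsSymmetricStableLevyMotion (α u) (Multistable.stableLevy S E (α u)) P ∧
      Multistable.IsLocalisableAt (Multistable.multistableLevy S E a α) (1 / α u) u
        (fun t ω => a u * Multistable.stableLevy S E (α u) t ω) P P) ∧
    -- part (b)
    (∀ u : ℝ, α u < 1 → deriv α u ≠ 0 →
      Multistable.SumConvergesAbsolutely S E (Multistable.tangentKernel a α u) P ∧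
      Multistable.HasScalingLimit (Multistable.multistableLevy S E a α) 1 u
        (fun t ω => t * Multistable.tangentVariable S E a α u ω) P P ∧
      (u ≠ 0 → Multistable.IsLocalisableAt (Multistable.multistableLevy S E a α) 1 u
        (fun t ω => t * Multistable.tangentVariable S E a α u ω) P P)) := by
  have hαd : ∀ u, DifferentiableAt ℝ α u := fun u => hα1.differentiable one_ne_zero u
  -- Both parts of the theorem exclude `α u = 1`, where `c` is given by a separate value.
  have hA : ∀ u, α u ≠ 1 →
      DifferentiableAt ℝ (fun v => a v * Multistable.stableConst (α v)) u := fun u hu =>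
    (ha1.differentiable one_ne_zero u).mul
      (DifferentiableAt.comp u (Multistable.differentiableAt_stableConst (hα u) hu) (hαd u))
  refine ⟨fun β hβ t => ⟨(Multistable.isSymmetricKernel_levyKernel hβ t).sumConverges hS hE,
    fun h => Multistable.sumConvergesAbsolutely_levyKernel hS hE hβ.1 h t⟩, fun u hu => ?_,
    fun u hu hu' => ?_⟩
  · exact ⟨Multistable.isSymmetricStableLevyMotion_stableLevy hS hE (hα u) hu.ne',
      Multistable.isLocalisableAt_of_one_lt hS hE hα (ha u).ne' (hA u hu.ne') (hαd u) hu⟩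
  · exact ⟨Multistable.sumConvergesAbsolutely_tangentKernel hS hE a (hα u).1 hu,
      Multistable.hasScalingLimit_of_lt_one hS hE hα (hA u hu.ne) (hαd u) hu,
      Multistable.isLocalisableAt_of_lt_one hS hE hα (ha u).ne' (hA u hu.ne) (hαd u) hu hu'⟩
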